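/- **Conventions.** Spins are elements of $\{0,\tfrac12,1,\tfrac32,\dots\}$; $q$ and $A$ are nonzero complex numbers (in applications $A$ and $q$ are tied, e.g. $A=q^2$ or $q=A^2$; the identities hold for independent $q$ and $A$). Put $[n]=q^{n-1}+q^{n-3}+\dots+q^{1-n}$, which is $\frac{q^n-q^{-n}}{q-q^{-1}}$ for $q\neq\pm1$, $[n]!=[1][2]\cdots[n]$, and let $\Delta_j=(-1)^{2j}[2j+1]$ be the loop value of the spin $j$. A triple $(a,b,c)$ of spins is admissible if $a+b+c\in\mathbb Z$, each spin is at most the sum of the other two, and $[a+b+c+1]!\neq0$ (the last condition is automatic unless $q^2$ is a root of unity of some order $r\ge2$, and then it says $a+b+c\le r-2$). The quantum Racah–Wigner symbol is $$\left\{\begin{array}{ccc}a&b&c\\d&e&f\end{array}\right\}^{RW}=\prod_{i=1}^4\delta(t_i)\ \cdot R,\qquad R=\sum_s\frac{(-1)^s[s+1]!}{\prod_{i=1}^4[s-T_i]!\,\prod_{j=1}^3[Q_j-s]!},$$ with triples $t_1=(a,b,c)$, $t_2=(a,e,f)$, $t_3=(d,b,f)$, $t_4=(d,e,c)$, $T_i$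 the sum of the entries of $t_i$, $Q_1=a+b+d+e$, $Q_2=a+c+d+f$, $Q_3=b+c+e+f$, $\max_i T_i\le s\le\min_j Q_j$, and $\delta(a,b,c)=\left(\frac{[a+b-c]!\,[a-b+c]!\,[-a+b+c]!}{[a+b+c+1]!}\right)^{1/2}$. The symbol normalized by unit theta nets is $$\left\{\begin{array}{ccc}a&b&c\\d&e&f\end{array}\right\}^{net}=\frac{\prod_{i,j}[Q_j-T_i]!}{[2a]!\,[2b]!\,[2c]!\,[2d]!\,[2e]!\,[2f]!}\cdot\frac{R}{\prod_{i=1}^4\theta(t_i)^{1/2}},\qquad \theta(a,b,c)=\frac{(-1)^{a+b+c}[a+b+c+1]!\,[a+b-c]!\,[a-b+c]!\,[-a+b+c]!}{[2a]!\,[2b]!\,[2c]!}.$$ Square roots are principal. Both symbols are $0$ unless all four triples are admissible. For spins put $\mathcal A^+_{a,b,c}=(-1)^{a+b-c}A^{2[a(a+1)+b(b+1)-c(c+1)]}$ (the exponents are integers when $(a,b,c)$ is admissible; when it is not, this factor is always multiplied by a vanishing $6j$-symbol). For either of the two $6j$-symbols the toroidal symbol with indices $(j_2,j_6)$ is $$\left[\begin{array}{ccc}j_1&j_4&j_7\\j_2&j_5&j_8\\j_3&j_6&j_9\end{array}\right]^{(j_2,j_6)}_{A,+}=\sum_x\Delta_x\,\mathcal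 A^+_{j_2,j_6,x}\left\{\begin{array}{ccc}j_1&j_2&j_3\\j_6&j_9&x\end{array}\right\}\left\{\begin{array}{ccc}j_4&j_5&j_6\\j_2&x&j_8\end{array}\right\}\left\{\begin{array}{ccc}j_7&j_8&j_9\\x&j_1&j_4\end{array}\right\}.$$ Sums over $x$ and $\mu$ run over all spins; only finitely many terms are nonzero. **Claim.** For all spins $j_1,j_2,j_3,j_4,j_5,j_6,j_8,j_9,\lambda$, the following two identities hold. With the $6j$-symbols normalized by unit theta nets, $$\sum_\mu\Delta_\mu\left[\begin{array}{ccc}j_1&j_4&\mu\\j_2&j_5&j_8\\j_3&j_6&j_9\end{array}\right]^{(j_2,j_6)}_{A,+}\left\{\begin{array}{ccc}j_1&j_4&\mu\\j_8&j_9&\lambda\end{array}\right\}=\mathcal A^+_{j_2,j_6,\lambda}\left\{\begin{array}{ccc}j_2&j_5&j_8\\j_4&\lambda&j_6\end{array}\right\}\left\{\begin{array}{ccc}j_3&j_6&j_9\\\lambda&j_1&j_2\end{array}\right\}.$$ With the quantum Racah–Wigner $6j$-symbols, $$\sum_\mu[2\mu+1]\left[\begin{array}{ccc}j_1&j_4&\mu\\j_2&j_5&j_8\\j_3&j_6&j_9\end{array}\right]^{(j_2,j_6)}_{A,+}\left\{\begin{array}{ccc}j_1&j_4&\mu\\j_8&j_9&\lambda\end{array}\right\}=(-1)^{2\lambda}\mathcal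 A^+_{j_2,j_6,\lambda}\left\{\begin{array}{ccc}j_2&j_5&j_8\\j_4&\lambda&j_6\end{array}\right\}\left\{\begin{array}{ccc}j_3&j_6&j_9\\\lambda&j_1&j_2\end{array}\right\}.$$ -/

import Mathlib

/-! Quantum `6j`-symbols and the toroidal symbol.

A spin `j ∈ {0, 1/2, 1, 3/2, …}` is encoded by the natural number `2 j`; thus every label
`a b c …  : ℕ` below stands for the spin `a / 2`, `b / 2`, `c / 2`, … -/

namespace QSpin

noncomputable section

/-- The quantum integer `[n] = q^(n-1) + q^(n-3) + ⋯ + q^(1-n)`. -/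
def qInt (q : ℂ) (n : ℕ) : ℂ :=
  ∑ k ∈ Finset.range n, q ^ ((n : ℤ) - 1 - 2 * (k : ℤ))

/-- Away from `q = ±1` the quantum integer is `(q^n - q^(-n)) / (q - q^(-1))`. -/
theorem qInt_eq_div (q : ℂ) (hq : q ≠ 0) (hq2 : q ^ 2 ≠ 1) (n : ℕ) :
    qInt q n = (q ^ n - (q ^ n)⁻¹) / (q - q⁻¹) := by
  have hd : q - q⁻¹ ≠ 0 := by
    intro h
    apply hq2
    field_simp at h
    linear_combination h
  rw [eq_div_iff hd, qInt, Finset.sum_mul]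
  have key : ∀ k ∈ Finset.range n,
      q ^ ((n : ℤ) - 1 - 2 * (k : ℤ)) * (q - q⁻¹) =
        q ^ ((n : ℤ) - 2 * (k : ℤ)) - q ^ ((n : ℤ) - 2 * ((k + 1 : ℕ) : ℤ)) := by
    intro k _
    rw [mul_sub]
    congr 1
    · rw [← zpow_add_one₀ hq]
      congr 1
      ring
    · rw [← zpow_sub_one₀ hq]
      congr 1
      push_cast
      ring
  rw [Finset.sum_congr rfl key,
    Finset.sum_range_sub' (fun k : ℕ => q ^ ((n : ℤ) - 2 * (k : ℤ))) n]
  have h1 : (n : ℤ) - 2 * ((n : ℕ) : ℤ) = -(n : ℤ) := by ring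
  rw [h1, zpow_neg, zpow_natCast]
  simp

/-- The quantum factorial `[n]! = [1][2]⋯[n]`. -/
def qFact (q : ℂ) (n : ℕ) : ℂ :=
  ∏ k ∈ Finset.range n, qInt q (k + 1)

/-- The loop value `Δ_j = (-1)^(2j) [2j+1]`. -/
def loopValue (q : ℂ) (a : ℕ) : ℂ :=
  (-1) ^ a * qInt q (a + 1)

/-- Admissibility of a triple of spins: the triangle inequalities hold, the sum of the three spins
is an integer, and `[j₁ + j₂ + j₃ + 1]! ≠ 0`.  The last condition is automatic unless `q²` is a
root of unity of some order `r ≥ 2`, where it is the usual condition `j₁ + j₂ + j₃ ≤ r - 2`. -/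
def Admissible (q : ℂ) (a b c : ℕ) : Prop :=
  Even (a + b + c) ∧ a ≤ b + c ∧ b ≤ a + c ∧ c ≤ a + b ∧ qFact q ((a + b + c) / 2 + 1) ≠ 0

/-- The four triples at the vertices of the tetrahedron of `{a b c; d e f}` are admissible. -/
def TetAdmissible (q : ℂ) (a b c d e f : ℕ) : Prop :=
  Admissible q a b c ∧ Admissible q a e f ∧ Admissible q d b f ∧ Admissible q d e c

/-- Racah's alternating sum
`∑ s, (-1)^s [s+1]! / (∏ᵢ [s - Tᵢ]! ∏ⱼ [Qⱼ - s]!)`, with `Tᵢ` the sums of the spins of the four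
triples and `Qⱼ` the sums of the spins of the three quadrilaterals of the tetrahedron. -/
def racahSum (q : ℂ) (a b c d e f : ℕ) : ℂ :=
  ∑ s ∈ Finset.Icc
      (max (max ((a + b + c) / 2) ((a + e + f) / 2)) (max ((d + b + f) / 2) ((d + e + c) / 2)))
      (min ((a + b + d + e) / 2) (min ((a + c + d + f) / 2) ((b + c + e + f) / 2))),
    (-1) ^ s * qFact q (s + 1) /
      ((qFact q (s - (a + b + c) / 2) * qFact q (s - (a + e + f) / 2) *
          qFact q (s - (d + b + f) / 2) * qFact q (s - (d + e + c) / 2)) *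
        (qFact q ((a + b + d + e) / 2 - s) * qFact q ((a + c + d + f) / 2 - s) *
          qFact q ((b + c + e + f) / 2 - s)))

/-- The triangle coefficient
`([j₁+j₂-j₃]! [j₁-j₂+j₃]! [-j₁+j₂+j₃]! / [j₁+j₂+j₃+1]!)^(1/2)`. -/
def triangleCoeff (q : ℂ) (a b c : ℕ) : ℂ :=
  (qFact q ((a + b - c) / 2) * qFact q ((a + c - b) / 2) * qFact q ((b + c - a) / 2) /
    qFact q ((a + b + c) / 2 + 1)) ^ (1 / 2 : ℂ)

open Classical in
/-- The quantum Racah–Wigner `6j`-symbol `{a b c; d e f}_q` (first row `a b c`, second row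
`d e f`), which is the classical one for `q = 1`; it vanishes unless all four triples are
admissible. -/
def racahSixJ (q : ℂ) (a b c d e f : ℕ) : ℂ :=
  if TetAdmissible q a b c d e f then
    triangleCoeff q a b c * triangleCoeff q a e f * triangleCoeff q d b f *
      triangleCoeff q d e c * racahSum q a b c d e f
  else 0

/-- The value of the theta net. -/
def thetaNet (q : ℂ) (a b c : ℕ) : ℂ :=
  (-1) ^ ((a + b + c) / 2) *
    (qFact q ((a + b + c) / 2 + 1) * qFact q ((a + b - c) / 2) * qFact q ((a + c - b) / 2) *
      qFact q ((b + c - a) / 2)) / (qFact q a * qFact q b * qFact q c)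

/-- The value of the tetrahedral net with vertices `(a,b,c)`, `(a,e,f)`, `(d,b,f)`, `(d,e,c)`:
the product of all `[Qⱼ - Tᵢ]!`, divided by the product of the `[2j]!` of the six spins, times
Racah's sum. -/
def tetNet (q : ℂ) (a b c d e f : ℕ) : ℂ :=
  (∏ j : Fin 3, ∏ i : Fin 4,
      qFact q (![a + b + d + e, a + c + d + f, b + c + e + f] j / 2 -
        ![a + b + c, a + e + f, d + b + f, d + e + c] i / 2)) /
    (qFact q a * qFact q b * qFact q c * qFact q d * qFact q e * qFact q f) *
    racahSum q a b c d e f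

open Classical in
/-- The quantum `6j`-symbol of spin networks whose vertices are normalized so that every theta net
has the value `1`, i.e. the tetrahedral net divided by `√θ` for each of its four vertices; it
vanishes unless all four triples are admissible. -/
def netSixJ (q : ℂ) (a b c d e f : ℕ) : ℂ :=
  if TetAdmissible q a b c d e f then
    tetNet q a b c d e f /
      (thetaNet q a b c ^ (1 / 2 : ℂ) * thetaNet q a e f ^ (1 / 2 : ℂ) *
        thetaNet q d b f ^ (1 / 2 : ℂ) * thetaNet q d e c ^ (1 / 2 : ℂ))
  else 0

/-- The twist factor
`𝒜⁺_{j₁,j₂,j₃} = (-1)^(j₁+j₂-j₃) A^(2[j₁(j₁+1) + j₂(j₂+1) - j₃(j₃+1)])` of an admissible triple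
(both exponents are then integers, see `twist_exponent`). -/
def twist (A : ℂ) (a b c : ℕ) : ℂ :=
  (-1) ^ ((a + b - c) / 2) *
    A ^ (((a : ℤ) * (a + 2) + (b : ℤ) * (b + 2) - (c : ℤ) * (c + 2)) / 2)

/-- For an admissible triple no rounding takes place in the exponent of `A` in `twist`. -/
theorem twist_exponent (a b c : ℕ) (h : Even (a + b + c)) :
    ((((a : ℤ) * (a + 2) + (b : ℤ) * (b + 2) - (c : ℤ) * (c + 2)) / 2 : ℤ) : ℚ) =
      2 * ((a / 2 : ℚ) * (a / 2 + 1) + (b / 2 : ℚ) * (b / 2 + 1) - (c / 2 : ℚ) * (c / 2 + 1)) := by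
  have h2 : (2 : ℤ) ∣ (a : ℤ) * (a + 2) + (b : ℤ) * (b + 2) - (c : ℤ) * (c + 2) := by
    rw [← even_iff_two_dvd]
    have h' : Even ((a : ℤ) + b + c) := by exact_mod_cast h
    rcases Int.even_or_odd (a : ℤ) with ha | ha <;> rcases Int.even_or_odd (b : ℤ) with hb | hb <;>
      rcases Int.even_or_odd (c : ℤ) with hc | hc <;>
      simp_all [Int.even_add, Int.even_sub, Int.even_mul, ← Int.not_even_iff_odd]
  rw [Int.cast_div h2 (by norm_num)]
  push_cast
  ring

/-- A `6j`-symbol, in either normalization, vanishes if one of the triples violates the triangle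
inequality, so sums over a spin of products of `6j`-symbols are finite. -/
theorem not_tetAdmissible (q : ℂ) (a b c d e f : ℕ) (h : a + b < c ∨ a + e < f) :
    ¬ TetAdmissible q a b c d e f := by
  rintro ⟨⟨_, _, _, h1, _⟩, ⟨_, _, _, h2, _⟩, _⟩
  omega

/-- The toroidal symbol with indices `(j₂, j₆)`,
`[j₁ j₄ j₇; j₂ j₅ j₈; j₃ j₆ j₉]_{A,+}^{(j₂,j₆)} =
  ∑ x, Δ_x 𝒜⁺_{j₂,j₆,x} {j₁ j₂ j₃; j₆ j₉ x} {j₄ j₅ j₆; j₂ x j₈} {j₇ j₈ j₉; x j₁ j₄}`,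
formed with the `6j`-symbol `S` (one of `racahSixJ q` and `netSixJ q`).  The arguments are listed
column by column. The first `6j`-symbol vanishes for `x > j₁ + j₉`, so the sum is over all `x`. -/
def toroidalSymbol (S : ℕ → ℕ → ℕ → ℕ → ℕ → ℕ → ℂ) (q A : ℂ)
    (j₁ j₂ j₃ j₄ j₅ j₆ j₇ j₈ j₉ : ℕ) : ℂ :=
  ∑ x ∈ Finset.range (j₁ + j₉ + 1),
    loopValue q x * twist A j₂ j₆ x *
      S j₁ j₂ j₃ j₆ j₉ x * S j₄ j₅ j₆ j₂ x j₈ * S j₇ j₈ j₉ x j₁ j₄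

end

end QSpin

/-! Everything rests on the orthogonality of the 6j-symbols. Insert the definition of the toroidal
symbol and exchange the sums over x and μ. By the tetrahedral symmetries the third 6j-symbol, the
only one containing μ, has the same shape as the symbol it is summed against, so the sum over μ is
an orthogonality sum and leaves only x = λ. The other two 6j-symbols and the twist factor are then
the right-hand side. For unit theta nets the orthogonality weight is the loop value itself; for
Racah–Wigner symbols it is [2x+1], and the leftover sign of the loop value is (-1)^(2λ). This is
`sum_toroidalSymbol_mul`.

Orthogonality is proved for every q ≠ 0, roots of unity included. Consider products [y][y-1]⋯ of N
quantum integers that interpolate between two strings of zeros (`productBasis`). Such a family with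
parameter p' in the variable y expands in the family with parameter p in the reflected variable N +
P - y; the coefficients are, up to factorials, terminating balanced sums (`productBasis_eq_sum`).
Raising the degree multiplies a basis element by one quantum integer, so the expansion follows by
induction from a contiguous relation of the balanced sums, which is verified termwise with a
telescoping certificate (`balancedTerm_contiguous`). Since the reflection is an involution and the
products are independent, the two connection matrices are inverse to each other. That is the
orthogonality of balanced sums (`sum_balancedWeight_mul`).

Racah's sum becomes a balanced sum on reversing the summation order. If [s+1]! vanishes within the
range of summation, the sum is cut at the last s = K with [K+1]! ≠ 0, and the reflection [r-n] =
±[n] restores the balanced form (`exists_level`). Finally, the square roots in the normalizations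
enter the orthogonality relation either as squares or as factors that leave the sum over μ. -/

namespace QSpin

noncomputable section

/-! ### Quantum integers and factorials on all integers, and their addition formulas. -/

/-- The quantum integer `[n]` of an integer `n`, odd in `n`. -/
def qBracket (q : ℂ) (n : ℤ) : ℂ :=
  if 0 ≤ n then qInt q n.toNat else -qInt q (-n).toNat

/-- The quantum factorial on the integers, extended by zero to the negative ones. -/
def qFactZ (q : ℂ) (n : ℤ) : ℂ :=
  if 0 ≤ n then qFact q n.toNat else 0

theorem qBracket_natCast (q : ℂ) (n : ℕ) : qBracket q n = qInt q n := by
  simp [qBracket]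

theorem qFactZ_natCast (q : ℂ) (n : ℕ) : qFactZ q n = qFact q n := by
  simp [qFactZ]

theorem qFactZ_of_neg (q : ℂ) {n : ℤ} (h : n < 0) : qFactZ q n = 0 := by
  simp [qFactZ, not_le.mpr h]

theorem qInt_one_base (n : ℕ) : qInt 1 n = n := by
  simp [qInt]

theorem qInt_neg_one_base (n : ℕ) : qInt (-1) n = -(-1) ^ n * n := by
  have h : ∀ k ∈ Finset.range n, (-1 : ℂ) ^ ((n : ℤ) - 1 - 2 * (k : ℤ)) = -(-1) ^ n := by
    intro k _
    rw [zpow_sub₀ (by norm_num), zpow_sub₀ (by norm_num), zpow_mul]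
    simp [div_neg]
  rw [qInt, Finset.sum_congr rfl h]
  simp
  ring

theorem qBracket_eq_div (q : ℂ) (hq : q ≠ 0) (hq2 : q ^ 2 ≠ 1) (n : ℤ) :
    qBracket q n = (q ^ n - (q ^ n)⁻¹) / (q - q⁻¹) := by
  unfold qBracket
  split_ifs with h
  · lift n to ℕ using h
    simpa using qInt_eq_div q hq hq2 n
  · obtain ⟨m, rfl⟩ : ∃ m : ℕ, n = -m := ⟨(-n).toNat, by omega⟩
    rw [neg_neg, Int.toNat_natCast, qInt_eq_div q hq hq2]
    simp
    ring

theorem qBracket_one_base (n : ℤ) : qBracket 1 n = n := by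
  unfold qBracket
  split_ifs with h
  · lift n to ℕ using h
    simp [qInt_one_base]
  · obtain ⟨m, rfl⟩ : ∃ m : ℕ, n = -m := ⟨(-n).toNat, by omega⟩
    simp [qInt_one_base]

theorem qBracket_neg_one_base (n : ℤ) : qBracket (-1) n = -(-1) ^ n * n := by
  unfold qBracket
  split_ifs with h
  · lift n to ℕ using h
    simp [qInt_neg_one_base]
  · obtain ⟨m, rfl⟩ : ∃ m : ℕ, n = -m := ⟨(-n).toNat, by omega⟩
    rw [neg_neg, Int.toNat_natCast, qInt_neg_one_base, zpow_neg, zpow_natCast]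
    have : ((-1 : ℂ) ^ m)⁻¹ = (-1) ^ m := by
      rw [← inv_pow]; norm_num
    rw [this]
    push_cast
    ring

@[simp]
theorem qBracket_zero (q : ℂ) : qBracket q 0 = 0 := by
  simp [qBracket, qInt]

theorem qBracket_neg (q : ℂ) (n : ℤ) : qBracket q (-n) = -qBracket q n := by
  unfold qBracket
  rcases lt_trichotomy n 0 with h | rfl | h
  · simp [h.le, not_le.mpr h]
  · simp [qInt]
  · simp [h.le, not_le.mpr h]

/-- The three-term relation of quantum integers. -/
theorem qBracket_three_term (q : ℂ) (hq : q ≠ 0) (x a b c : ℤ) :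
    qBracket q (x - a) * qBracket q (b - c) + qBracket q (x - b) * qBracket q (c - a) +
      qBracket q (x - c) * qBracket q (a - b) = 0 := by
  -- At q = ±1 the quotient formula for [n] degenerates; there [n] is n or -(-1)^n n, and the
  -- identity is checked directly.
  by_cases hq2 : q ^ 2 = 1
  · rcases sq_eq_one_iff.mp hq2 with rfl | rfl
    · simp only [qBracket_one_base]; push_cast; ring
    · simp only [qBracket_neg_one_base, zpow_sub₀ hq]
      have hx : ((-1 : ℂ)) ^ x ≠ 0 := zpow_ne_zero _ hq
      have ha : ((-1 : ℂ)) ^ a ≠ 0 := zpow_ne_zero _ hq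
      have hb : ((-1 : ℂ)) ^ b ≠ 0 := zpow_ne_zero _ hq
      have hc : ((-1 : ℂ)) ^ c ≠ 0 := zpow_ne_zero _ hq
      have hs : ∀ z : ℤ, ((-1 : ℂ) ^ z) * (-1) ^ z = 1 := by
        intro z; rw [← mul_zpow]; simp
      have ha' := hs a
      have hb' := hs b
      have hc' := hs c
      have inv : ∀ z : ℤ, ((-1 : ℂ) ^ z)⁻¹ = (-1) ^ z := by
        intro z; exact inv_eq_of_mul_eq_one_left (hs z)
      simp only [div_eq_mul_inv, inv]
      push_cast
      ring
  · simp only [qBracket_eq_div q hq hq2, zpow_sub₀ hq]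
    have hd : q - q⁻¹ ≠ 0 := by
      intro h; apply hq2; field_simp at h; linear_combination h
    generalize q - q⁻¹ = d at hd
    have hx : q ^ x ≠ 0 := zpow_ne_zero _ hq
    have ha : q ^ a ≠ 0 := zpow_ne_zero _ hq
    have hb : q ^ b ≠ 0 := zpow_ne_zero _ hq
    have hc : q ^ c ≠ 0 := zpow_ne_zero _ hq
    generalize q ^ x = X at *
    generalize q ^ a = A at *
    generalize q ^ b = B at *
    generalize q ^ c = C at *
    field_simp
    ring

/-- The left side vanishes at G = 0; the right side displays the quotient by [G], split into two
products so that they match consecutive values of `balancedCertificate`. -/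
theorem qBracket_quartic (q : ℂ) (hq : q ≠ 0) (k p D G j : ℤ) :
    qBracket q k * qBracket q (k + p) * qBracket q D * qBracket q (G + j) -
        qBracket q (G + k) * qBracket q (G + k + p) * qBracket q (D - G) * qBracket q j =
      qBracket q G * (qBracket q (k - j) * qBracket q (k - j + p) * qBracket q (D + j) -
        qBracket q j * qBracket q (D - G - p - 2 * k + j) * qBracket q (G + j)) := by
  by_cases hq2 : q ^ 2 = 1
  · rcases sq_eq_one_iff.mp hq2 with rfl | rfl
    · simp only [qBracket_one_base]; push_cast; ring
    · have hs : ∀ z : ℤ, ((-1 : ℂ) ^ z) ^ 2 = 1 := by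
        intro z; rw [← zpow_natCast, zpow_comm]; simp
      have inv : ∀ z : ℤ, ((-1 : ℂ) ^ z)⁻¹ = (-1) ^ z := by
        intro z; apply inv_eq_of_mul_eq_one_left; rw [← sq, hs z]
      simp only [qBracket_neg_one_base, zpow_sub₀ hq, zpow_add₀ hq, div_eq_mul_inv, inv, two_mul]
      have h1 := hs k
      have h2 := hs p
      have h3 := hs D
      have h4 := hs G
      have h5 := hs j
      generalize (-1 : ℂ) ^ k = K at *
      generalize (-1 : ℂ) ^ p = P at *
      generalize (-1 : ℂ) ^ D = D' at *
      generalize (-1 : ℂ) ^ G = G' at *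
      generalize (-1 : ℂ) ^ j = J at *
      push_cast
      have h8 : J ^ 3 = J := by linear_combination J * h5
      have h10 : K⁻¹ ^ 2 = 1 := by rw [inv_pow, h1, inv_one]
      have h9 : G' ^ 3 = G' := by linear_combination G' * h4
      ring_nf
      simp only [h1, h8, h9, h10]
      ring
  · simp only [qBracket_eq_div q hq hq2, zpow_sub₀ hq, zpow_add₀ hq, two_mul]
    have hd : q - q⁻¹ ≠ 0 := by
      intro h; apply hq2; field_simp at h; linear_combination h
    generalize q - q⁻¹ = d at hd
    have hk : q ^ k ≠ 0 := zpow_ne_zero _ hq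
    have hp : q ^ p ≠ 0 := zpow_ne_zero _ hq
    have hD : q ^ D ≠ 0 := zpow_ne_zero _ hq
    have hG : q ^ G ≠ 0 := zpow_ne_zero _ hq
    have hj : q ^ j ≠ 0 := zpow_ne_zero _ hq
    generalize q ^ k = K at *
    generalize q ^ p = P at *
    generalize q ^ D = D' at *
    generalize q ^ G = G' at *
    generalize q ^ j = J at *
    field_simp
    ring

theorem qFact_succ (q : ℂ) (n : ℕ) : qFact q (n + 1) = qFact q n * qInt q (n + 1) := by
  simp [qFact, Finset.prod_range_succ]

theorem qFactZ_zero (q : ℂ) : qFactZ q 0 = 1 := by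
  simp [qFactZ, qFact]

theorem qFactZ_pred (q : ℂ) {n : ℤ} (h : 0 < n) :
    qFactZ q n = qBracket q n * qFactZ q (n - 1) := by
  obtain ⟨m, rfl⟩ : ∃ m : ℕ, n = (m + 1 : ℕ) := ⟨(n - 1).toNat, by omega⟩
  have : ((m + 1 : ℕ) : ℤ) - 1 = (m : ℕ) := by push_cast; ring
  rw [this, qFactZ_natCast, qFactZ_natCast, qBracket_natCast, qFact_succ, mul_comm]

theorem qFact_ne_zero_mono {q : ℂ} {m n : ℕ} (h : m ≤ n) (hn : qFact q n ≠ 0) :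
    qFact q m ≠ 0 := by
  unfold qFact at *
  rw [Finset.prod_ne_zero_iff] at *
  intro k hk
  exact hn k (Finset.mem_range.mpr (by have := Finset.mem_range.mp hk; omega))

theorem qFactZ_ne_zero_mono {q : ℂ} {m n : ℤ} (h0 : 0 ≤ m) (h : m ≤ n) (hn : qFactZ q n ≠ 0) :
    qFactZ q m ≠ 0 := by
  lift m to ℕ using h0
  lift n to ℕ using (by omega)
  rw [qFactZ_natCast] at *
  exact qFact_ne_zero_mono (by omega) hn

theorem qBracket_ne_zero {q : ℂ} {m n : ℤ} (h0 : 0 < m) (h : m ≤ n) (hn : qFactZ q n ≠ 0) :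
    qBracket q m ≠ 0 := by
  have := qFactZ_ne_zero_mono h0.le h hn
  rw [qFactZ_pred q h0] at this
  exact left_ne_zero_of_mul this

/-- For m ≤ 0 both sides are 0, since 1/[m]! is read as 0 at negative m. Hence the recursion needs
no lower bound on m; the upper bound n keeps [m] from vanishing at a root of unity. -/
theorem qBracket_mul_inv_qFactZ {q : ℂ} {m n : ℤ} (h : m ≤ n) (hn : qFactZ q n ≠ 0) :
    qBracket q m * (qFactZ q m)⁻¹ = (qFactZ q (m - 1))⁻¹ := by
  rcases lt_trichotomy m 0 with h0 | rfl | h0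
  · rw [qFactZ_of_neg q h0, qFactZ_of_neg q (by omega)]; simp
  · rw [qFactZ_of_neg q (by omega : (0 : ℤ) - 1 < 0)]; simp
  · rw [qFactZ_pred q h0, mul_inv, ← mul_assoc, mul_inv_cancel₀ (qBracket_ne_zero h0 h hn),
      one_mul]

/-- The Weierstrass relation of quantum integers. -/
theorem qBracket_weierstrass (q : ℂ) (hq : q ≠ 0) (N l p R : ℤ) :
    qBracket q (R - 2 * l - p) * qBracket q N * qBracket q (N + p) * qBracket q R =
      qBracket q l * qBracket q (l + p) * qBracket q (R - N - l - p) * qBracket q (R + N - l) +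
        qBracket q (R - l) * qBracket q (R - l - p) * qBracket q (N - l) *
          qBracket q (N + p + l) := by
  by_cases hq2 : q ^ 2 = 1
  · rcases sq_eq_one_iff.mp hq2 with rfl | rfl
    · simp only [qBracket_one_base]; push_cast; ring
    · have hs : ∀ z : ℤ, ((-1 : ℂ) ^ z) ^ 2 = 1 := by
        intro z; rw [← zpow_natCast, zpow_comm]; simp
      have inv : ∀ z : ℤ, ((-1 : ℂ) ^ z)⁻¹ = (-1) ^ z := by
        intro z; apply inv_eq_of_mul_eq_one_left; rw [← sq, hs z]
      simp only [qBracket_neg_one_base, zpow_sub₀ hq, zpow_add₀ hq, div_eq_mul_inv, inv, two_mul]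
      have h1 := hs N
      have h2 := hs p
      have h3 := hs l
      have h4 := hs R
      generalize (-1 : ℂ) ^ N = N' at *
      generalize (-1 : ℂ) ^ p = P at *
      generalize (-1 : ℂ) ^ l = L at *
      generalize (-1 : ℂ) ^ R = R' at *
      push_cast
      have h5 : (L * L)⁻¹ = 1 := by rw [← sq, h3, inv_one]
      have h6 : L ^ 4 = 1 := by linear_combination (L ^ 2 + 1) * h3
      rw [h5]
      ring_nf
      simp only [h1, h2, h4, h6]
      ring
  · simp only [qBracket_eq_div q hq hq2, zpow_sub₀ hq, zpow_add₀ hq, two_mul]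
    have hd : q - q⁻¹ ≠ 0 := by
      intro h; apply hq2; field_simp at h; linear_combination h
    generalize q - q⁻¹ = d at hd
    have hN : q ^ N ≠ 0 := zpow_ne_zero _ hq
    have hp : q ^ p ≠ 0 := zpow_ne_zero _ hq
    have hl : q ^ l ≠ 0 := zpow_ne_zero _ hq
    have hR : q ^ R ≠ 0 := zpow_ne_zero _ hq
    generalize q ^ N = N' at *
    generalize q ^ p = P at *
    generalize q ^ l = L at *
    generalize q ^ R = R' at *
    field_simp
    ring

/-! ### Balanced sums and their contiguous relation. -/

/-- The reciprocal of the quantum factorial, extended by zero to the negative integers. -/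
def qFactInv (q : ℂ) (n : ℤ) : ℂ := (qFactZ q n)⁻¹

theorem qFactInv_of_neg (q : ℂ) {n : ℤ} (h : n < 0) : qFactInv q n = 0 := by
  simp [qFactInv, qFactZ_of_neg q h]

theorem qFactInv_pred {q : ℂ} {m n : ℤ} (h : m ≤ n) (hn : qFactZ q n ≠ 0) :
    qFactInv q (m - 1) = qBracket q m * qFactInv q m :=
  (qBracket_mul_inv_qFactZ h hn).symm

/-- A summand of the balanced sum behind Racah's formula. -/
def balancedTerm (q : ℂ) (N p p' P k l j : ℤ) : ℂ :=
  (-1) ^ j * qFactZ q (p + p' + P + 2 * N + 1 - j) *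
    (qFactInv q j * qFactInv q (k - j) * qFactInv q (k - j + p) * qFactInv q (l - j) *
      qFactInv q (l - j + p') * qFactInv q (N - k - l + j) * qFactInv q (N - k - l + j + P))

/-- The telescoping companion of `balancedTerm` in its contiguous relation. -/
def balancedCertificate (q : ℂ) (N p p' P k l j : ℤ) : ℂ :=
  (-1) ^ j * qFactZ q (p + p' + P + 2 * N + 1 - j) *
    (qFactInv q (j - 1) * qFactInv q (k - j) * qFactInv q (k - j + p) * qFactInv q (l - j) *
      qFactInv q (l - j + p') * qFactInv q (N - k - l + j - 1) * qFactInv q (N - k - l + j + P))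

/-- After a common product of factorials is removed, a polynomial identity in quantum integers
remains. Put G = N-k-l+P+1. `qBracket_quartic` combines the left side with the term at (l-1, j-1)
into [G] times two products. The second product is the certificate at j; the first is split by the
three-term relation into the term at (k-1, l) and the certificate at j+1. -/
theorem balancedTerm_contiguous {q : ℂ} (hq : q ≠ 0) {N p p' P k l j : ℤ} (hp : 0 ≤ p)
    (hp' : 0 ≤ p') (hP : 0 ≤ P) (hk : 0 ≤ k) (hkN : k ≤ N) (hl : 0 ≤ l) (hlN : l ≤ N)
    (hj : 0 ≤ j) (hjN : j ≤ N) (hQ : qFactZ q (p + p' + P + 2 * N + 1) ≠ 0) :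
    qBracket q k * qBracket q (k + p) * qBracket q (p + P + 2 * N + 1 - 2 * l) *
        balancedTerm q N p p' P k l j =
      qBracket q (N - k - l + P + 1) * qBracket q (p + p' + P + 2 * N + 1 - l) *
          qBracket q (p + P + 2 * N + 1 - l) * balancedTerm q (N - 1) p p' (P + 1) (k - 1) l j -
        qBracket q (N - l + P + 1) * qBracket q (N - l + P + 1 + p) * qBracket q (N + p + k - l) *
          balancedTerm q (N - 1) p p' (P + 1) (k - 1) (l - 1) (j - 1) +
        qBracket q (N - k - l + P + 1) *
          (balancedCertificate q N p p' P k l (j + 1) - balancedCertificate q N p p' P k l j) := by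
  have e1 : qFactZ q (p + p' + P + 2 * N + 1 - j) =
      qBracket q (p + p' + P + 2 * N + 1 - j) * qFactZ q (p + p' + P + 2 * N - j) := by
    rw [qFactZ_pred q (by omega)]
    congr 2; ring
  have e2 := qFactInv_pred (m := j) (by omega) hQ
  have e3 := qFactInv_pred (m := k - j) (by omega) hQ
  have e4 := qFactInv_pred (m := k - j + p) (by omega) hQ
  have e5 := qFactInv_pred (m := l - j) (by omega) hQ
  have e6 := qFactInv_pred (m := l - j + p') (by omega) hQ
  have e7 := qFactInv_pred (m := N - k - l + j) (by omega) hQ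
  have e8 := qFactInv_pred (m := N - k - l + P + 1 + j) (by omega) hQ
  have hw := qBracket_three_term q hq (p + p' + P + 2 * N + 1 - j) (l - j)
    (p + P + 2 * N + 1 - l) 0
  have hquart := qBracket_quartic q hq k p (p + P + 2 * N + 1 - 2 * l) (N - k - l + P + 1) j
  simp only [balancedTerm, balancedCertificate]
  rw [show p + p' + (P + 1) + 2 * (N - 1) + 1 - j = p + p' + P + 2 * N - j by ring,
    show p + p' + (P + 1) + 2 * (N - 1) + 1 - (j - 1) = p + p' + P + 2 * N + 1 - j by ring,
    show p + p' + P + 2 * N + 1 - (j + 1) = p + p' + P + 2 * N - j by ring,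
    show k - 1 - j = k - j - 1 by ring, show k - j - 1 + p = k - j + p - 1 by ring,
    show k - 1 - (j - 1) = k - j by ring, show l - 1 - (j - 1) = l - j by ring,
    show N - 1 - (k - 1) - l + j = N - k - l + j by ring,
    show N - 1 - (k - 1) - (l - 1) + (j - 1) = N - k - l + j by ring,
    show N - k - l + j + (P + 1) = N - k - l + P + 1 + j by ring,
    show N - k - l + j + P = N - k - l + P + 1 + j - 1 by ring,
    show k - (j + 1) = k - j - 1 by ring, show l - (j + 1) = l - j - 1 by ring,
    show j + 1 - 1 = j by ring, show k - j - 1 + p = k - j + p - 1 by ring,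
    show l - j - 1 + p' = l - j + p' - 1 by ring,
    show N - k - l + (j + 1) - 1 = N - k - l + j by ring,
    show N - k - l + (j + 1) + P = N - k - l + P + 1 + j by ring,
    zpow_sub_one₀ (by norm_num), zpow_add_one₀ (by norm_num), e1, e2, e3, e4, e5, e6, e7, e8]
  rw [show p + p' + P + 2 * N + 1 - j - (l - j) = p + p' + P + 2 * N + 1 - l by ring,
    show p + p' + P + 2 * N + 1 - j - (p + P + 2 * N + 1 - l) = l - j + p' by ring,
    show (0 : ℤ) - (l - j) = -(l - j) by ring,
    show l - j - (p + P + 2 * N + 1 - l) = -(p + P + 2 * N + 1 - 2 * l + j) by ring,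
    qBracket_neg, qBracket_neg, sub_zero, sub_zero] at hw
  rw [show N - k - l + P + 1 + k = N - l + P + 1 by ring,
    show p + P + 2 * N + 1 - 2 * l - (N - k - l + P + 1) = N + p + k - l by ring,
    show N + p + k - l - p - 2 * k + j = N - k - l + j by ring] at hquart
  clear e1 e2 e3 e4 e5 e6 e7 e8
  generalize qFactZ q (p + p' + P + 2 * N - j) = F
  generalize qFactInv q j = r1
  generalize qFactInv q (k - j) = r2
  generalize qFactInv q (k - j + p) = r3
  generalize qFactInv q (l - j) = r4
  generalize qFactInv q (l - j + p') = r5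
  generalize qFactInv q (N - k - l + j) = r6
  generalize qFactInv q (N - k - l + P + 1 + j) = r7
  linear_combination
    (qBracket q (p + p' + P + 2 * N + 1 - j) *
      ((-1) ^ j * F * (r1 * r2 * r3 * r4 * r5 * r6 * r7))) * hquart -
    (qBracket q (N - k - l + P + 1) * qBracket q (k - j) * qBracket q (k - j + p) *
      ((-1) ^ j * F * (r1 * r2 * r3 * r4 * r5 * r6 * r7))) * hw

/-- The balanced sum behind Racah's formula. -/
def balancedSum (q : ℂ) (N : ℕ) (p p' P k l : ℤ) : ℂ :=
  ∑ j ∈ Finset.range (N + 1), balancedTerm q N p p' P k l j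

/-- Summing the termwise relation over j makes the certificate telescope. It vanishes at both ends:
at j = 0 through 1/[-1]!, and beyond the range through 1/[k-j]!. -/
theorem balancedSum_contiguous {q : ℂ} (hq : q ≠ 0) {N : ℕ} {p p' P k l : ℤ} (hp : 0 ≤ p)
    (hp' : 0 ≤ p') (hP : 0 ≤ P) (hk : 0 ≤ k) (hkN : k ≤ N + 1) (hl : 0 ≤ l) (hlN : l ≤ N + 1)
    (hQ : qFactZ q (p + p' + P + 2 * (N + 1) + 1) ≠ 0) :
    qBracket q k * qBracket q (k + p) * qBracket q (p + P + 2 * (N + 1) + 1 - 2 * l) *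
        balancedSum q (N + 1) p p' P k l =
      qBracket q (N + 1 - k - l + P + 1) * qBracket q (p + p' + P + 2 * (N + 1) + 1 - l) *
          qBracket q (p + P + 2 * (N + 1) + 1 - l) * balancedSum q N p p' (P + 1) (k - 1) l -
        qBracket q (N + 1 - l + P + 1) * qBracket q (N + 1 - l + P + 1 + p) *
          qBracket q (N + 1 + p + k - l) * balancedSum q N p p' (P + 1) (k - 1) (l - 1) := by
  have s2 : balancedSum q N p p' (P + 1) (k - 1) l =
      ∑ j ∈ Finset.range (N + 1 + 1), balancedTerm q N p p' (P + 1) (k - 1) l j := by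
    rw [Finset.sum_range_succ, balancedSum, left_eq_add, balancedTerm,
      qFactInv_of_neg q (by push_cast; omega : k - 1 - ((N + 1 : ℕ) : ℤ) < 0)]
    ring
  have s1 : balancedSum q N p p' (P + 1) (k - 1) (l - 1) =
      ∑ j ∈ Finset.range (N + 1 + 1),
        balancedTerm q N p p' (P + 1) (k - 1) (l - 1) ((j : ℤ) - 1) := by
    have h0 : balancedTerm q N p p' (P + 1) (k - 1) (l - 1) (((0 : ℕ) : ℤ) - 1) = 0 := by
      rw [balancedTerm, qFactInv_of_neg q (by simp : ((0 : ℕ) : ℤ) - 1 < 0)]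
      ring
    rw [Finset.sum_range_succ', balancedSum, h0, add_zero]
    simp
  have s3 : ∑ j ∈ Finset.range (N + 1 + 1),
      (balancedCertificate q (N + 1) p p' P k l ((j : ℤ) + 1) -
        balancedCertificate q (N + 1) p p' P k l j) = 0 := by
    have := Finset.sum_range_sub
      (fun j : ℕ => balancedCertificate q (N + 1) p p' P k l (j : ℤ)) (N + 1 + 1)
    push_cast at this
    rw [this, balancedCertificate, balancedCertificate,
      qFactInv_of_neg q (by omega : k - ((N : ℤ) + 1 + 1) < 0),
      qFactInv_of_neg q (by omega : (0 : ℤ) - 1 < 0)]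
    ring
  rw [s1, s2, balancedSum]
  refine Eq.trans ?_ (add_zero _)
  rw [← mul_zero (qBracket q (N + 1 - k - l + P + 1)), ← s3]
  simp only [Finset.mul_sum]
  rw [← Finset.sum_sub_distrib, ← Finset.sum_add_distrib]
  refine Finset.sum_congr rfl fun j hj => ?_
  have hj' := Finset.mem_range.mp hj
  have := balancedTerm_contiguous (N := N + 1) hq hp hp' hP hk (by omega) hl (by omega)
    (Int.natCast_nonneg j) (by omega) hQ
  rw [add_sub_cancel_right] at this
  push_cast
  exact this

theorem balancedSum_of_neg {q : ℂ} {N : ℕ} {p p' P k l : ℤ} (hl : l < 0) :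
    balancedSum q N p p' P k l = 0 := by
  refine Finset.sum_eq_zero fun j _ => ?_
  rw [balancedTerm, qFactInv_of_neg q (by omega : l - j < 0)]
  ring

theorem balancedSum_of_gt {q : ℂ} {N : ℕ} {p p' P k l : ℤ} (hl : N < l) :
    balancedSum q N p p' P k l = 0 := by
  refine Finset.sum_eq_zero fun j _ => ?_
  rw [balancedTerm]
  rcases lt_or_ge k j with h | h
  · rw [qFactInv_of_neg q (by omega : k - j < 0)]
    ring
  · rw [qFactInv_of_neg q (by omega : N - k - l + j < 0)]
    ring

theorem balancedSum_zero_left {q : ℂ} {N : ℕ} {p p' P l : ℤ} :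
    balancedSum q N p p' P 0 l = qFactZ q (p + p' + P + 2 * N + 1) *
      (qFactInv q p * qFactInv q l * qFactInv q (l + p') * qFactInv q (N - l) *
        qFactInv q (N - l + P)) := by
  rw [balancedSum, Finset.sum_range_succ', Finset.sum_eq_zero]
  · simp [balancedTerm, qFactInv, qFactZ_zero]
  · intro j _
    rw [balancedTerm, qFactInv_of_neg q (by omega : 0 - ((j + 1 : ℕ) : ℤ) < 0)]
    ring

/-! ### Product bases and the connection coefficients between them. -/

/-- The falling product `[y] [y - 1] ⋯ [y - n + 1]`. -/
def qFalling (q : ℂ) (y : ℤ) (n : ℕ) : ℂ := ∏ i ∈ Finset.range n, qBracket q (y - i)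

theorem qFalling_succ (q : ℂ) (y : ℤ) (n : ℕ) :
    qFalling q y (n + 1) = qFalling q y n * qBracket q (y - n) :=
  Finset.prod_range_succ _ _

/-- A basis of the trigonometric polynomials of degree `N`. -/
def productBasis (q : ℂ) (N : ℕ) (p P : ℤ) (k : ℕ) (y : ℤ) : ℂ :=
  qFalling q y k * qFalling q (y - (N + p + P + 1)) (N - k)

theorem productBasis_succ_succ (q : ℂ) (N : ℕ) (p P : ℤ) (k : ℕ) (y : ℤ) :
    productBasis q (N + 1) p P (k + 1) y = qBracket q (y - k) * productBasis q N p (P + 1) k y := by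
  rw [productBasis, productBasis, qFalling_succ, Nat.add_sub_add_right]
  have : ((N + 1 : ℕ) : ℤ) + p + P + 1 = N + p + (P + 1) + 1 := by push_cast; ring
  rw [this]
  ring

theorem productBasis_succ (q : ℂ) {N : ℕ} (p P : ℤ) {k : ℕ} (hk : k ≤ N) (y : ℤ) :
    productBasis q (N + 1) p P k y =
      qBracket q (y - (N + p + P + 2) - (N - k)) * productBasis q N p (P + 1) k y := by
  rw [productBasis, productBasis, Nat.succ_sub hk, qFalling_succ]
  have h1 : ((N + 1 : ℕ) : ℤ) + p + P + 1 = N + p + P + 2 := by push_cast; ring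
  have h2 : (N : ℤ) + p + (P + 1) + 1 = N + p + P + 2 := by ring
  rw [h1, h2, Nat.cast_sub hk]
  ring

/-- The coefficients, up to a quantum integer, expressing one product basis in another. -/
def connectionCoeff (q : ℂ) (N : ℕ) (p p' P : ℤ) (k : ℕ) (l : ℤ) : ℂ :=
  (-1) ^ k * (qFactZ q k * qFactZ q (k + p) * qFactZ q (N - k) * qFactZ q (N - k + p')) *
    ((-1) ^ l * (qFactZ q (N - l + P) * qFactZ q (N - l + p + P) *
      qFactInv q (p + p' + P + 2 * N + 1 - l) * qFactInv q (p + P + 2 * N + 1 - l))) *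
    balancedSum q N p p' P k l

/-- This is `balancedSum_contiguous` at k + 1 after multiplication by the prefactors, whose ratios
absorb the quantum integers there. The shape is the recursion required by `sum_productBasis_succ`
with w = k. -/
theorem connectionCoeff_succ {q : ℂ} (hq : q ≠ 0) {N k : ℕ} {p p' P l : ℤ} (hp : 0 ≤ p)
    (hp' : 0 ≤ p') (hP : 0 ≤ P) (hkN : k ≤ N) (hl : 0 ≤ l) (hlN : l ≤ N + 1)
    (hQ : qFactZ q (p + p' + P + 2 * (N + 1) + 1) ≠ 0) :
    qBracket q (p + P + 2 * (N + 1) + 1 - 2 * l) * connectionCoeff q (N + 1) p p' P (k + 1) l =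
      -qBracket q (N + 1 + P - k - l) * connectionCoeff q N p p' (P + 1) k l -
        qBracket q (k + p + 1 + N - (l - 1)) * connectionCoeff q N p p' (P + 1) k (l - 1) := by
  have hc := balancedSum_contiguous (N := N) (k := k + 1) (l := l) hq hp hp' hP (by omega)
    (by omega) hl hlN hQ
  have e1 : qFactZ q (k + 1) = qBracket q (k + 1) * qFactZ q k := by
    rw [qFactZ_pred q (by omega)]
    simp
  have e2 : qFactZ q (k + 1 + p) = qBracket q (k + 1 + p) * qFactZ q (k + p) := by
    rw [qFactZ_pred q (by omega)]
    congr 2; ring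
  have e3 : qFactZ q (N + 1 - l + P + 1) =
      qBracket q (N + 1 - l + P + 1) * qFactZ q (N + 1 - l + P) := by
    rw [qFactZ_pred q (by omega), add_sub_cancel_right]
  have e4 : qFactZ q (N + 1 - l + P + 1 + p) =
      qBracket q (N + 1 - l + P + 1 + p) * qFactZ q (N + 1 - l + p + P) := by
    rw [qFactZ_pred q (by omega)]
    congr 2; ring
  have e5 := qFactInv_pred (m := p + p' + P + 2 * (N + 1) + 1 - l) (by omega) hQ
  have e6 := qFactInv_pred (m := p + P + 2 * (N + 1) + 1 - l) (by omega) hQ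
  simp only [connectionCoeff]
  push_cast
  rw [show (N : ℤ) - l + (P + 1) = N + 1 - l + P by ring,
    show (N : ℤ) - l + p + (P + 1) = N + 1 - l + p + P by ring,
    show p + p' + (P + 1) + 2 * (N : ℤ) + 1 - l = p + p' + P + 2 * (N + 1) + 1 - l - 1 by ring,
    show p + (P + 1) + 2 * (N : ℤ) + 1 - l = p + P + 2 * (N + 1) + 1 - l - 1 by ring,
    show p + p' + (P + 1) + 2 * (N : ℤ) + 1 - (l - 1) = p + p' + P + 2 * (N + 1) + 1 - l by ring,
    show p + (P + 1) + 2 * (N : ℤ) + 1 - (l - 1) = p + P + 2 * (N + 1) + 1 - l by ring,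
    show (N : ℤ) - (l - 1) + (P + 1) = N + 1 - l + P + 1 by ring,
    show (N : ℤ) - (l - 1) + p + (P + 1) = N + 1 - l + P + 1 + p by ring,
    show (N : ℤ) + 1 - (k + 1) = N - k by ring, zpow_sub_one₀ (by norm_num),
    e1, e2, e3, e4, e5, e6, pow_succ]
  rw [show (N : ℤ) + 1 - (k + 1) - l + P + 1 = N + 1 + P - k - l by ring,
    show (N : ℤ) + 1 + p + (k + 1) - l = k + p + 1 + N - (l - 1) by ring,
    show (k : ℤ) + 1 - 1 = k by ring] at hc
  clear e1 e2 e3 e4 e5 e6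
  linear_combination (-(-1) ^ k * (qFactZ q k * qFactZ q (k + p) * qFactZ q (N - k) *
    qFactZ q (N - k + p')) * ((-1) ^ l * (qFactZ q (N + 1 - l + P) * qFactZ q (N + 1 - l + p + P) *
      qFactInv q (p + p' + P + 2 * (N + 1) + 1 - l) *
      qFactInv q (p + P + 2 * (N + 1) + 1 - l)))) * hc

/-- At k = 0 only the term j = 0 of the balanced sum survives, so all three coefficients are
explicit products and the recursion reduces to the Weierstrass relation. It is the recursion of
`sum_productBasis_succ` with w = 2N + p' + P + 2. -/
theorem connectionCoeff_zero_succ {q : ℂ} (hq : q ≠ 0) {N : ℕ} {p p' P l : ℤ} (hp : 0 ≤ p)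
    (hp' : 0 ≤ p') (hP : 0 ≤ P) (hl : 0 ≤ l) (hlN : l ≤ N + 1)
    (hQ : qFactZ q (p + p' + P + 2 * (N + 1) + 1) ≠ 0) :
    qBracket q (p + P + 2 * (N + 1) + 1 - 2 * l) * connectionCoeff q (N + 1) p p' P 0 l =
      -qBracket q (N + 1 + P - (N + p' + P + 2 + N) - l) *
          connectionCoeff q N p p' (P + 1) 0 l -
        qBracket q (N + p' + P + 2 + N + p + 1 + N - (l - 1)) *
          connectionCoeff q N p p' (P + 1) 0 (l - 1) := by
  have hw := qBracket_weierstrass q hq (N + 1) l p' (p + p' + P + 2 * (N + 1) + 1)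
  have e1 : qFactZ q (N + 1) = qBracket q (N + 1) * qFactZ q N := by
    rw [qFactZ_pred q (by omega)]
    simp
  have e2 : qFactZ q (N + 1 + p') = qBracket q (N + 1 + p') * qFactZ q (N + p') := by
    rw [qFactZ_pred q (by omega)]
    congr 2; ring
  have e4 : qFactZ q (N + 1 - l + P + 1 + p) =
      qBracket q (N + 1 - l + P + 1 + p) * qFactZ q (N + 1 - l + p + P) := by
    rw [qFactZ_pred q (by omega)]
    congr 2; ring
  have e5 := qFactInv_pred (m := p + p' + P + 2 * (N + 1) + 1 - l) (by omega) hQ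
  have e6 := qFactInv_pred (m := p + P + 2 * (N + 1) + 1 - l) (by omega) hQ
  have e7 := qFactInv_pred (m := l) (by omega) hQ
  have e8 := qFactInv_pred (m := l + p') (by omega) hQ
  have e9 := qFactInv_pred (m := N + 1 - l) (by omega) hQ
  have e10 : qFactZ q (p + p' + P + 2 * (N + 1) + 1) =
      qBracket q (p + p' + P + 2 * (N + 1) + 1) * qFactZ q (p + p' + P + 2 * (N + 1)) := by
    rw [qFactZ_pred q (by omega), add_sub_cancel_right]
  have e11 : qFactZ q (N + 1 - l + P + 1) * qFactInv q (N + 1 - l + P + 1) =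
      qFactZ q (N + 1 - l + P) * qFactInv q (N + 1 - l + P) := by
    rw [qFactInv, qFactInv,
      mul_inv_cancel₀ (qFactZ_ne_zero_mono (by omega) (by omega) hQ),
      mul_inv_cancel₀ (qFactZ_ne_zero_mono (by omega) (by omega) hQ)]
  simp only [connectionCoeff, CharP.cast_eq_zero, balancedSum_zero_left]
  push_cast
  rw [show (N : ℤ) - l + (P + 1) = N + 1 - l + P by ring,
    show (N : ℤ) - l + p + (P + 1) = N + 1 - l + p + P by ring,
    show p + p' + (P + 1) + 2 * (N : ℤ) + 1 - l = p + p' + P + 2 * (N + 1) + 1 - l - 1 by ring,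
    show p + (P + 1) + 2 * (N : ℤ) + 1 - l = p + P + 2 * (N + 1) + 1 - l - 1 by ring,
    show p + p' + (P + 1) + 2 * (N : ℤ) + 1 = p + p' + P + 2 * (N + 1) by ring,
    show p + p' + P + 2 * ((N : ℤ) + 1) - (l - 1) = p + p' + P + 2 * (N + 1) + 1 - l by ring,
    show p + (P + 1) + 2 * (N : ℤ) + 1 - (l - 1) = p + P + 2 * (N + 1) + 1 - l by ring,
    show (N : ℤ) - (l - 1) + (P + 1) = N + 1 - l + P + 1 by ring,
    show (N : ℤ) - (l - 1) + p + (P + 1) = N + 1 - l + P + 1 + p by ring,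
    show l - 1 + p' = l + p' - 1 by ring, show (N : ℤ) - l = N + 1 - l - 1 by ring,
    show (N : ℤ) - (l - 1) = N + 1 - l by ring,
    show (N : ℤ) + 1 + P - (N + p' + P + 2 + N) - l = -(N + 1 + p' + l) by ring,
    show (N : ℤ) + p' + P + 2 + N + p + 1 + N - (l - 1) =
      p + p' + P + 2 * (N + 1) + 1 + (N + 1) - l by ring,
    zpow_sub_one₀ (by norm_num), qBracket_neg, sub_zero, sub_zero]
  rw [e1, e2, e4, e5, e6, e7, e8, e9, e10]
  rw [show p + p' + P + 2 * (N + 1) + 1 - 2 * l - p' = p + P + 2 * (N + 1) + 1 - 2 * l by ring,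
    show p + p' + P + 2 * (N + 1) + 1 - (N + 1) - l - p' = (N : ℤ) + 1 - l + P + 1 + p by ring,
    show p + p' + P + 2 * (N + 1) + 1 - l - p' = p + P + 2 * ((N : ℤ) + 1) + 1 - l by ring] at hw
  clear e1 e2 e4 e5 e6 e7 e8 e9 e10
  generalize qFactZ q (N + 1 - l + P + 1) = x1 at *
  generalize qFactInv q (N + 1 - l + P + 1) = x2 at *
  generalize qFactZ q (N + 1 - l + P) = x3 at *
  generalize qFactInv q (N + 1 - l + P) = x4 at *
  linear_combination
    ((-1) ^ l * (qFactZ q 0 * qFactZ q (0 + p) * qFactZ q N * qFactZ q (N + p')) *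
      (x3 * x4 * qFactZ q (N + 1 - l + p + P) *
        qFactInv q (p + p' + P + 2 * (N + 1) + 1 - l) *
        qFactInv q (p + P + 2 * (N + 1) + 1 - l)) *
      (qFactZ q (p + p' + P + 2 * (N + 1)) *
        (qFactInv q p * qFactInv q l * qFactInv q (l + p') * qFactInv q (N + 1 - l)))) * hw -
    ((-1) ^ l * (qFactZ q 0 * qFactZ q (0 + p) * qFactZ q N * qFactZ q (N + p')) *
      (qBracket q (N + 1 - l + P + 1 + p) * qFactZ q (N + 1 - l + p + P) *
        qFactInv q (p + p' + P + 2 * (N + 1) + 1 - l) *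
        qFactInv q (p + P + 2 * (N + 1) + 1 - l)) *
      (qFactZ q (p + p' + P + 2 * (N + 1)) *
        (qFactInv q p * (qBracket q l * qFactInv q l) *
          (qBracket q (l + p') * qFactInv q (l + p')) * qFactInv q (N + 1 - l))) *
      qBracket q (p + p' + P + 2 * (N + 1) + 1 + (N + 1) - l)) * e11

/-- An element of degree N extends to degree N + 1 by one more zero in either string. By the
three-term relation, any factor [Y - c] is a combination of the two corresponding factors; the
denominator, a quantum integer, is kept on the left to avoid division. -/
theorem qBracket_mul_productBasis {q : ℂ} (hq : q ≠ 0) {N l : ℕ} {p P w Y : ℤ} (hl : l ≤ N) :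
    qBracket q (N + 1 + P - Y - w) * (qBracket q (p + (P + 1) + 2 * N + 1 - 2 * l) *
        productBasis q N p (P + 1) l Y) =
      -qBracket q (w + p + 1 + N - l) * productBasis q (N + 1) p P (l + 1) Y -
        qBracket q (N + 1 + P - w - l) * productBasis q (N + 1) p P l Y := by
  rw [productBasis_succ_succ, productBasis_succ q p P hl]
  have h := qBracket_three_term q hq Y (N + 1 + P - w) l (N + p + P + 2 + (N - l))
  rw [show Y - (N + 1 + P - w) = -(N + 1 + P - Y - w) by ring,
    show (l : ℤ) - (N + p + P + 2 + (N - l)) = -(p + (P + 1) + 2 * N + 1 - 2 * l) by ring,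
    show (N : ℤ) + p + P + 2 + (N - l) - (N + 1 + P - w) = w + p + 1 + N - l by ring,
    show Y - (N + p + P + 2 + (N - l)) = Y - (N + p + P + 2) - (N - l) by ring,
    qBracket_neg, qBracket_neg] at h
  linear_combination productBasis q N p (P + 1) l Y * h

/-- The element l of degree N feeds the elements l and l + 1 of degree N + 1; `hd` collects the
coefficients of each. The vanishing of c at -1 and N + 1 supplies the boundary cases. -/
theorem sum_productBasis_succ {q : ℂ} (hq : q ≠ 0) {N : ℕ} {p P w Y : ℤ} {c d : ℤ → ℂ}
    (h0 : c (-1) = 0) (hN : c (N + 1) = 0)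
    (hd : ∀ l : ℤ, 0 ≤ l → l ≤ N + 1 → d l =
      -qBracket q (N + 1 + P - w - l) * c l - qBracket q (w + p + 1 + N - (l - 1)) * c (l - 1)) :
    qBracket q (N + 1 + P - Y - w) * ∑ l ∈ Finset.range (N + 1),
        qBracket q (p + (P + 1) + 2 * N + 1 - 2 * l) * c l * productBasis q N p (P + 1) l Y =
      ∑ l ∈ Finset.range (N + 1 + 1), d l * productBasis q (N + 1) p P l Y := by
  have h1 : ∀ l ∈ Finset.range (N + 1 + 1), d l * productBasis q (N + 1) p P l Y =
      -qBracket q (N + 1 + P - w - l) * c l * productBasis q (N + 1) p P l Y +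
        -qBracket q (w + p + 1 + N - ((l : ℤ) - 1)) * c ((l : ℤ) - 1) *
          productBasis q (N + 1) p P l Y := by
    intro l hl
    rw [hd l (by omega) (by have := Finset.mem_range.mp hl; omega)]
    ring
  rw [Finset.sum_congr rfl h1, Finset.sum_add_distrib, Finset.sum_range_succ (n := N + 1),
    Finset.sum_range_succ' (n := N + 1)]
  push_cast
  rw [hN, h0, mul_zero, mul_zero, zero_mul, add_zero, zero_mul, add_zero,
    ← Finset.sum_add_distrib, Finset.mul_sum]
  refine Finset.sum_congr rfl fun l hl => ?_
  have := qBracket_mul_productBasis (Y := Y) (w := w) (p := p) (P := P) hq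
    (Nat.lt_succ_iff.mp (Finset.mem_range.mp hl))
  rw [add_sub_cancel_right]
  linear_combination c l * this

theorem connectionCoeff_of_neg {q : ℂ} {N k : ℕ} {p p' P l : ℤ} (hl : l < 0) :
    connectionCoeff q N p p' P k l = 0 := by
  rw [connectionCoeff, balancedSum_of_neg hl, mul_zero]

theorem connectionCoeff_of_gt {q : ℂ} {N k : ℕ} {p p' P l : ℤ} (hl : N < l) :
    connectionCoeff q N p p' P k l = 0 := by
  rw [connectionCoeff, balancedSum_of_gt hl, mul_zero]

theorem productBasis_zero_eq_sum {q : ℂ} (hq : q ≠ 0) {p p' : ℤ} (hp : 0 ≤ p) (hp' : 0 ≤ p')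
    (y : ℤ) (N : ℕ) : ∀ {P : ℤ}, 0 ≤ P → qFactZ q (p + p' + P + 2 * N + 1) ≠ 0 →
    productBasis q N p' P 0 y = ∑ l ∈ Finset.range (N + 1),
      qBracket q (p + P + 2 * N + 1 - 2 * l) * connectionCoeff q N p p' P 0 l *
        productBasis q N p P l (N + P - y) := by
  induction N with
  | zero =>
    intro P hP hQ
    have h0 : ∀ {n : ℤ}, 0 ≤ n → n ≤ p + p' + P + 1 → qFactZ q n ≠ 0 := fun h h' =>
      qFactZ_ne_zero_mono h (by push_cast; linarith) hQ
    have h1 : qFactZ q (p + P + 1) = qBracket q (p + P + 1) * qFactZ q (p + P) := by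
      rw [qFactZ_pred q (by omega), add_sub_cancel_right]
    have h2 := h0 (n := p + P + 1) (by omega) (by omega)
    rw [h1] at h2
    have h3 := left_ne_zero_of_mul h2
    have h4 := right_ne_zero_of_mul h2
    have h5 := h0 hp (by omega)
    have h6 := h0 hp' (by omega)
    have h7 := h0 hP (by omega)
    have h8 := h0 (n := p + p' + P + 1) (by omega) le_rfl
    simp [productBasis, qFalling, connectionCoeff, balancedSum_zero_left, qFactInv, qFactZ_zero, h1]
    field_simp
  | succ N ih =>
    intro P hP hQ
    push_cast at hQ
    have := ih (P := P + 1) (by omega) (by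
      apply qFactZ_ne_zero_mono (by omega) (by omega) hQ)
    -- Raising N by one lowers P by one, which fixes N + P and hence the reflected variable.
    rw [productBasis_succ q p' P (Nat.zero_le N), this]
    have hs := sum_productBasis_succ (N := N) (P := P) (p := p) (Y := N + 1 + P - y)
      (w := N + p' + P + 2 + N) (c := connectionCoeff q N p p' (P + 1) 0)
      (d := fun l => qBracket q (p + P + 2 * (N + 1) + 1 - 2 * l) *
        connectionCoeff q (N + 1) p p' P 0 l) hq (connectionCoeff_of_neg (by omega))
      (connectionCoeff_of_gt (by omega))
      (fun l hl hlN => connectionCoeff_zero_succ hq hp hp' hP hl hlN hQ)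
    push_cast
    rw [show (N : ℤ) + 1 + P - (N + 1 + P - y) - (N + p' + P + 2 + N) =
      y - (N + p' + P + 2) - (N - 0) by ring] at hs
    rw [← hs, show (N : ℤ) + (P + 1) - y = N + 1 + P - y by ring]

/-- A product basis expanded in another one, by means of balanced sums. -/
theorem productBasis_eq_sum {q : ℂ} (hq : q ≠ 0) {p p' : ℤ} (hp : 0 ≤ p) (hp' : 0 ≤ p')
    (y : ℤ) (k : ℕ) : ∀ {N : ℕ} {P : ℤ}, k ≤ N → 0 ≤ P →
    qFactZ q (p + p' + P + 2 * N + 1) ≠ 0 →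
    productBasis q N p' P k y = ∑ l ∈ Finset.range (N + 1),
      qBracket q (p + P + 2 * N + 1 - 2 * l) * connectionCoeff q N p p' P k l *
        productBasis q N p P l (N + P - y) := by
  induction k with
  | zero => exact fun _ hP hQ => productBasis_zero_eq_sum hq hp hp' y _ hP hQ
  | succ k ih =>
    intro N P hkN hP hQ
    obtain ⟨N, rfl⟩ : ∃ M, N = M + 1 := ⟨N - 1, by omega⟩
    push_cast at hQ
    have := ih (N := N) (P := P + 1) (by omega) (by omega) (by
      apply qFactZ_ne_zero_mono (by omega) (by omega) hQ)
    rw [productBasis_succ_succ, this]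
    have hs := sum_productBasis_succ (N := N) (P := P) (p := p) (Y := N + 1 + P - y)
      (w := k) (c := connectionCoeff q N p p' (P + 1) k)
      (d := fun l => qBracket q (p + P + 2 * (N + 1) + 1 - 2 * l) *
        connectionCoeff q (N + 1) p p' P (k + 1) l) hq (connectionCoeff_of_neg (by omega))
      (connectionCoeff_of_gt (by omega))
      (fun l hl hlN => connectionCoeff_succ hq hp hp' hP (by omega) hl hlN hQ)
    push_cast
    rw [show (N : ℤ) + 1 + P - (N + 1 + P - y) - k = y - k by ring] at hs
    rw [← hs, show (N : ℤ) + (P + 1) - y = N + 1 + P - y by ring]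

/-! ### Independence of the product basis and orthogonality of balanced sums. -/

theorem qFalling_eq_zero {q : ℂ} {m n : ℕ} (h : m < n) : qFalling q m n = 0 :=
  Finset.prod_eq_zero (Finset.mem_range.mpr h) (by simp)

theorem productBasis_self_ne_zero {q : ℂ} {N k : ℕ} {p P : ℤ} (hp : 0 ≤ p) (hP : 0 ≤ P)
    (hk : k ≤ N) (hQ : qFactZ q (p + P + 2 * N) ≠ 0) : productBasis q N p P k k ≠ 0 := by
  refine mul_ne_zero (Finset.prod_ne_zero_iff.mpr fun i hi => ?_)
    (Finset.prod_ne_zero_iff.mpr fun i hi => ?_)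
  · have := Finset.mem_range.mp hi
    exact qBracket_ne_zero (by omega) (by omega) hQ
  · have := Finset.mem_range.mp hi
    rw [show (k : ℤ) - (N + p + P + 1) - i = -(N + p + P + 1 + i - k) by ring, qBracket_neg]
    exact neg_ne_zero.mpr (qBracket_ne_zero (by omega) (by omega) hQ)

/-- Evaluation at y = 0, …, N is triangular: at y = k every element of index above k contains the
factor [0], while the element k does not vanish. -/
theorem productBasis_independent {q : ℂ} {N : ℕ} {p P : ℤ} (hp : 0 ≤ p) (hP : 0 ≤ P)
    (hQ : qFactZ q (p + P + 2 * N) ≠ 0) {c : ℕ → ℂ}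
    (h : ∀ y : ℤ, ∑ k ∈ Finset.range (N + 1), c k * productBasis q N p P k y = 0) :
    ∀ k ≤ N, c k = 0 := by
  intro k
  induction k using Nat.strong_induction_on with
  | _ k ih =>
    intro hk
    have := h k
    rw [Finset.sum_eq_single k] at this
    · exact (mul_eq_zero.mp this).resolve_right (productBasis_self_ne_zero hp hP hk hQ)
    · intro i hi hik
      rcases lt_or_gt_of_ne hik with h1 | h1
      · rw [ih i h1 (by omega), zero_mul]
      · rw [productBasis, qFalling_eq_zero h1]
        ring
    · intro h1
      exact absurd (Finset.mem_range.mpr (by omega)) h1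

/-- By this symmetry the inverse connection matrix is built from the same balanced sums, so that
inversion of matrices becomes orthogonality. -/
theorem balancedSum_symm (q : ℂ) (N : ℕ) (p p' P k l : ℤ) :
    balancedSum q N p p' P k l = balancedSum q N p' p P l k := by
  refine Finset.sum_congr rfl fun j _ => ?_
  rw [balancedTerm, balancedTerm, show p' + p + P = p + p' + P by ring,
    show (N : ℤ) - l - k = N - k - l by ring]
  ring

/-- The weight in the orthogonality relation of balanced sums. -/
def balancedWeight (q : ℂ) (N : ℕ) (p p' P k : ℤ) : ℂ :=
  qBracket q (p' + P + 2 * N + 1 - 2 * k) *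
    (qFactZ q k * qFactZ q (k + p) * qFactZ q (N - k) * qFactZ q (N - k + p') *
      qFactZ q (N - k + P) * qFactZ q (N - k + p' + P)) *
    (qFactInv q (p + p' + P + 2 * N + 1 - k) * qFactInv q (p' + P + 2 * N + 1 - k))

theorem connection_mul_connection (q : ℂ) (N k k' l : ℕ) (p p' P : ℤ) :
    qBracket q (p + P + 2 * N + 1 - 2 * l) * connectionCoeff q N p p' P k l *
      (qBracket q (p' + P + 2 * N + 1 - 2 * k') * connectionCoeff q N p' p P l k') *
      (qFactZ q k' * qFactZ q (k' + p) * qFactZ q (N - k') * qFactZ q (N - k' + p')) =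
    (-1) ^ (k + k') * (qFactZ q k * qFactZ q (k + p) * qFactZ q (N - k) * qFactZ q (N - k + p')) *
      balancedWeight q N p p' P k' *
      (balancedWeight q N p' p P l * balancedSum q N p p' P k l * balancedSum q N p p' P k' l) := by
  have h1 : ∀ z : ℂ, ((-1 : ℂ) ^ l) * (-1) ^ l * z = z := fun z => by rw [← mul_pow]; simp
  refine Eq.trans ?_ (h1 _)
  rw [connectionCoeff, connectionCoeff, balancedWeight, balancedWeight,
    balancedSum_symm q N p' p P l k',
    show p' + p + P = p + p' + P by ring, zpow_natCast, zpow_natCast]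
  ring

/-- Orthogonality of balanced sums. -/
theorem sum_balancedWeight_mul {q : ℂ} (hq : q ≠ 0) {N k k' : ℕ} {p p' P : ℤ} (hp : 0 ≤ p)
    (hp' : 0 ≤ p') (hP : 0 ≤ P) (hk : k ≤ N) (hk' : k' ≤ N)
    (hQ : qFactZ q (p + p' + P + 2 * N + 1) ≠ 0) :
    balancedWeight q N p p' P k' * ∑ l ∈ Finset.range (N + 1),
        balancedWeight q N p' p P l * balancedSum q N p p' P k l * balancedSum q N p p' P k' l =
      if k = k' then 1 else 0 := by
  have hQ' : qFactZ q (p' + p + P + 2 * N + 1) ≠ 0 := by rwa [add_comm p' p]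
  -- Expanding from p' to p and back to p' returns to the variable y, because y ↦ N + P - y is an
  -- involution. By independence the product of the two connection matrices is the identity.
  have key : ∀ i ≤ N, ∑ l ∈ Finset.range (N + 1),
      qBracket q (p + P + 2 * N + 1 - 2 * l) * connectionCoeff q N p p' P k l *
        (qBracket q (p' + P + 2 * N + 1 - 2 * i) * connectionCoeff q N p' p P l i) -
      (if k = i then 1 else 0) = 0 := by
    refine productBasis_independent (q := q) (p := p') (P := P) hp' hP
      (qFactZ_ne_zero_mono (by omega) (by omega) hQ) fun y => ?_
    have h1 := productBasis_eq_sum hq hp hp' y k hk hP hQ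
    simp only [sub_mul, Finset.sum_sub_distrib, ite_mul, one_mul, zero_mul]
    rw [Finset.sum_ite_eq, if_pos (Finset.mem_range.mpr (by omega)), h1, sub_eq_zero]
    simp only [Finset.sum_mul]
    rw [Finset.sum_comm]
    refine Finset.sum_congr rfl fun l hl => ?_
    have h2 := productBasis_eq_sum hq hp' hp (N + P - y) l
      (Nat.lt_succ_iff.mp (Finset.mem_range.mp hl)) hP hQ'
    rw [h2, Finset.mul_sum]
    refine Finset.sum_congr rfl fun i _ => ?_
    rw [sub_sub_cancel]
    ring
  have h0 : ∀ i ≤ N, qFactZ q i * qFactZ q (i + p) * qFactZ q (N - i) *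
      qFactZ q (N - i + p') ≠ 0 := fun i hi => by
    have h : ∀ {n : ℤ}, 0 ≤ n → n ≤ p + p' + P + 2 * N + 1 → qFactZ q n ≠ 0 := fun h h' =>
      qFactZ_ne_zero_mono h h' hQ
    exact mul_ne_zero (mul_ne_zero (mul_ne_zero (h (by omega) (by omega))
      (h (by omega) (by omega))) (h (by omega) (by omega))) (h (by omega) (by omega))
  have h1 := congrArg (· * (qFactZ q k' * qFactZ q (k' + p) * qFactZ q (N - k') *
    qFactZ q (N - k' + p'))) (sub_eq_zero.mp (key k' hk'))
  simp only [Finset.sum_mul, connection_mul_connection] at h1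
  rw [← Finset.mul_sum] at h1
  have h2 : ((-1 : ℂ) ^ (k + k')) ≠ 0 := pow_ne_zero _ (by norm_num)
  apply mul_left_cancel₀ (mul_ne_zero h2 (h0 k hk))
  rw [← mul_assoc, h1]
  split_ifs with h
  · subst h
    rw [← two_mul, pow_mul]
    simp
  · simp

/-! ### Reflection of quantum factorials at roots of unity. -/

theorem qBracket_reflect {q : ℂ} (hq : q ≠ 0) {r : ℤ} (hr : 0 < r) (h : qBracket q r = 0) :
    ∃ ε : ℂ, ε * ε = 1 ∧ ∀ n : ℤ, qBracket q (r - n) = ε * qBracket q n := by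
  have hr' : (r : ℂ) ≠ 0 := by exact_mod_cast hr.ne'
  by_cases hq2 : q ^ 2 = 1
  · exfalso
    rcases sq_eq_one_iff.mp hq2 with rfl | rfl
    · rw [qBracket_one_base] at h
      exact hr' h
    · rw [qBracket_neg_one_base] at h
      have : ((-1 : ℂ)) ^ r ≠ 0 := zpow_ne_zero _ hq
      simp_all
  · have hd : q - q⁻¹ ≠ 0 := by
      intro h; apply hq2; field_simp at h; linear_combination h
    have hqr : q ^ r ≠ 0 := zpow_ne_zero _ hq
    rw [qBracket_eq_div q hq hq2, div_eq_zero_iff, or_iff_left hd, sub_eq_zero] at h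
    have h1 : q ^ r * q ^ r = 1 := by
      nth_rewrite 1 [h]
      exact inv_mul_cancel₀ hqr
    -- [r] = 0 means q^(2r) = 1, so q^r is its own inverse and the sign is ε = -q^r.
    refine ⟨-q ^ r, by rw [neg_mul_neg, h1], fun n => ?_⟩
    have hqn : q ^ n ≠ 0 := zpow_ne_zero _ hq
    rw [qBracket_eq_div q hq hq2, qBracket_eq_div q hq hq2, zpow_sub₀ hq]
    rw [inv_div, div_eq_mul_inv (q ^ n), ← h]
    ring

theorem qFactZ_reflect {q : ℂ} {r : ℤ} {ε : ℂ} (h : ∀ n : ℤ, qBracket q (r - n) = ε * qBracket q n)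
    (hε : ε * ε = 1) (n : ℕ) (hn : n < r) :
    qFactZ q (r - 1 - n) * qFactZ q n = ε ^ n * qFactZ q (r - 1) := by
  induction n with
  | zero => simp [qFactZ_zero]
  | succ n ih =>
    have h1 := ih (by omega)
    rw [qFactZ_pred q (by omega : 0 < r - 1 - (n : ℤ)), show r - 1 - (n : ℤ) = r - (n + 1 : ℕ) by
      push_cast; ring, h] at h1
    rw [qFactZ_pred q (by omega : 0 < ((n + 1 : ℕ) : ℤ)), pow_succ,
      show r - 1 - ((n + 1 : ℕ) : ℤ) = r - (n + 1 : ℕ) - 1 by ring,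
      show ((n + 1 : ℕ) : ℤ) - 1 = n by push_cast; ring]
    linear_combination ε * h1 - (qFactZ q (r - (n + 1 : ℕ) - 1) *
      (qBracket q (n + 1 : ℕ) * qFactZ q n)) * hε

/-- For every `S`, there is a largest `K ≤ S` with `[K + 1]! ≠ 0`, and `S` may be exchanged for
`K` in the quotients of quantum factorials in Racah's sum. -/
theorem exists_level {q : ℂ} (hq : q ≠ 0) (S : ℕ) :
    ∃ (K : ℕ) (C : ℂ), K ≤ S ∧ C * C = 1 ∧ qFactZ q (K + 1) ≠ 0 ∧
      (∀ s : ℤ, K < s → s ≤ S → qFactZ q (s + 1) = 0) ∧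
      ∀ j : ℤ, 0 ≤ j → j ≤ 2 * K - S →
        qFactZ q (K + 1 - j) * qFactInv q (S - K + j) =
          C * (qFactZ q (2 * K - S + 1 - j) * qFactInv q j) := by
  have one : qFact q 1 ≠ 0 := by simp [qFact, qInt]
  by_cases hS : qFactZ q (S + 1) = 0
  · have hex : ∃ n : ℕ, qFact q n = 0 := ⟨S + 1, by rw [← qFactZ_natCast]; exact_mod_cast hS⟩
    classical
    obtain ⟨r, hr, hmin⟩ : ∃ r : ℕ, qFact q r = 0 ∧ ∀ n < r, qFact q n ≠ 0 :=
      ⟨Nat.find hex, Nat.find_spec hex, fun n hn => Nat.find_min hex hn⟩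
    have hr2 : 2 ≤ r := by
      by_contra hlt
      exact qFact_ne_zero_mono (by omega : r ≤ 1) one hr
    -- With r the first index where [r]! = 0, the last admissible s satisfies s + 1 = r - 1, that is
    -- s = r - 2.
    obtain ⟨K, rfl⟩ : ∃ K, r = K + 2 := ⟨r - 2, by omega⟩
    have hK : qFactZ q (K + 1) ≠ 0 := by
      have := hmin (K + 1) (by omega)
      rw [← qFactZ_natCast] at this
      exact_mod_cast this
    have hvan : ∀ n : ℤ, (K : ℤ) + 2 ≤ n → qFactZ q n = 0 := fun n hn => by
      by_contra h0
      have := qFactZ_ne_zero_mono (m := ((K + 2 : ℕ) : ℤ)) (by omega) (by push_cast; exact hn) h0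
      rw [qFactZ_natCast] at this
      exact this hr
    have hKS : K + 1 ≤ S := by
      by_contra hlt
      exact qFactZ_ne_zero_mono (by omega) (by omega : (S : ℤ) + 1 ≤ K + 1) hK hS
    have hbr : qBracket q (K + 2) = 0 := by
      have := hvan (K + 2) le_rfl
      rw [qFactZ_pred q (by omega), show (K : ℤ) + 2 - 1 = K + 1 by ring] at this
      exact (mul_eq_zero.mp this).resolve_right hK
    obtain ⟨ε, hε, hrefl⟩ := qBracket_reflect hq (by omega) hbr
    obtain ⟨d, rfl⟩ := Nat.exists_eq_add_of_le (show K ≤ S by omega)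
    refine ⟨K, ε ^ d, by omega, by rw [← mul_pow, hε, one_pow], hK,
      fun s hs _ => hvan _ (by omega), fun j hj hjK => ?_⟩
    lift j to ℕ using hj
    have h1 := qFactZ_reflect hrefl hε j (by omega)
    have h2 := qFactZ_reflect hrefl hε (d + j) (by omega)
    have h3 : qFactZ q j ≠ 0 := qFactZ_ne_zero_mono (by omega) (by omega) hK
    have h4 : qFactZ q (d + j : ℕ) ≠ 0 := qFactZ_ne_zero_mono (by omega) (by omega) hK
    have h6 : (ε ^ d) * ε ^ d = 1 := by rw [← mul_pow, hε, one_pow]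
    rw [show (K : ℤ) + 2 - 1 = K + 1 by ring] at h1 h2
    push_cast at h2 h4 ⊢
    rw [pow_add] at h2
    rw [show (K : ℤ) + d - K + j = d + j by ring,
      show 2 * (K : ℤ) - (K + d) + 1 - j = K + 1 - (d + j) by ring, qFactInv, qFactInv]
    field_simp
    linear_combination h1 - ε ^ d * h2 - (ε ^ j * qFactZ q (K + 1)) * h6
  · refine ⟨S, 1, le_rfl, by norm_num, hS, fun s hs hs' => by omega, fun j _ _ => ?_⟩
    rw [show 2 * (S : ℤ) - S + 1 - j = S + 1 - j by ring, show (S : ℤ) - S + j = j by ring, one_mul]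

/-! ### Racah's sum in symmetric parameters. -/

/-- Racah's sum for six spins whose sums over the four triples are `(S ± p' + m)/2`,
`(S ± p + x)/2` and over the three quadrilaterals are `S`, `(S ± P + m + x)/2`. -/
def symmetricRacahSum (q : ℂ) (S : ℕ) (p p' P m x : ℤ) : ℂ :=
  ∑ s ∈ Finset.range (S + 1), (-1) ^ s * qFactZ q (s + 1) *
    (qFactInv q (s - (S + p' + m) / 2) * qFactInv q (s - (S - p' + m) / 2) *
      qFactInv q (s - (S + p + x) / 2) * qFactInv q (s - (S - p + x) / 2) *
      (qFactInv q (S - s) * qFactInv q ((S - P + m + x) / 2 - s) *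
        qFactInv q ((S + P + m + x) / 2 - s)))

/-- The weight of the spin `m / 2` in the orthogonality relation of Racah's sums. -/
def symmetricWeight (q : ℂ) (S : ℕ) (p p' P m : ℤ) : ℂ :=
  qBracket q (m + 1) *
    (qFactZ q ((S - p' - m) / 2) * qFactZ q ((S + p' - m) / 2) * qFactZ q ((m - P - p) / 2) *
      qFactZ q ((m - P + p) / 2) * qFactZ q ((m + P - p) / 2) * qFactZ q ((m + P + p) / 2)) *
    (qFactInv q ((S + p' + m) / 2 + 1) * qFactInv q ((S - p' + m) / 2 + 1))

/-- Substitute s = K - j. The factor [s+1]!/[S-s]! becomes [K+1-j]!/[S-K+j]!, which `hrel` turns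
into the corresponding quotient of the balanced sum; the other factorials agree literally. -/
theorem symmetricRacahSum_eq {q : ℂ} {S K N : ℕ} {C : ℂ} {p p' P k l : ℤ} (hKS : K ≤ S)
    (hp : 0 ≤ p) (hp' : 0 ≤ p') (hP : 0 ≤ P) (hk : k ≤ N)
    (hN : 2 * (K : ℤ) - S = p + p' + P + 2 * N)
    (hvan : ∀ s : ℤ, K < s → s ≤ S → qFactZ q (s + 1) = 0)
    (hrel : ∀ j : ℤ, 0 ≤ j → j ≤ 2 * K - S → qFactZ q (K + 1 - j) * qFactInv q (S - K + j) =
      C * (qFactZ q (2 * K - S + 1 - j) * qFactInv q j)) :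
    symmetricRacahSum q S p p' P (2 * (K - l) - S - p') (2 * (K - k) - S - p) =
      (-1) ^ K * C * balancedSum q N p p' P k l := by
  have h1 : ∀ s ∈ Finset.range (S + 1), s ∉ Finset.range (K + 1) →
      (-1) ^ s * qFactZ q (s + 1) *
        (qFactInv q (s - (K - l)) * qFactInv q (s - (K - l - p')) *
          qFactInv q (s - (K - k)) * qFactInv q (s - (K - k - p)) *
          (qFactInv q (S - s) * qFactInv q (K + N - k - l - s) *
            qFactInv q (K + N - k - l + P - s))) = 0 := by
    intro s hs hs'
    rw [Finset.mem_range] at hs hs'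
    rw [hvan s (by omega) (by omega)]
    ring
  have h2 : ∀ j ∈ Finset.range (K + 1), j ∉ Finset.range (N + 1) →
      (-1) ^ K * C * balancedTerm q N p p' P k l j = 0 := by
    intro j hj hj'
    rw [Finset.mem_range] at hj hj'
    rw [balancedTerm, qFactInv_of_neg q (by omega : k - j < 0)]
    ring
  -- Both sums are brought to the range 0, …, K: the balanced one is padded with zeros beyond N, and
  -- Racah's is cut at K, after which [s+1]! = 0.
  rw [balancedSum, Finset.mul_sum, Finset.sum_subset (by simp; omega) h2,
    ← Finset.sum_range_reflect, symmetricRacahSum,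
    show ((S : ℤ) + p' + (2 * (K - l) - S - p')) / 2 = K - l by omega,
    show ((S : ℤ) - p' + (2 * (K - l) - S - p')) / 2 = K - l - p' by omega,
    show ((S : ℤ) + p + (2 * (K - k) - S - p)) / 2 = K - k by omega,
    show ((S : ℤ) - p + (2 * (K - k) - S - p)) / 2 = K - k - p by omega,
    show ((S : ℤ) - P + (2 * (K - l) - S - p') + (2 * (K - k) - S - p)) / 2 = K + N - k - l by
      omega,
    show ((S : ℤ) + P + (2 * (K - l) - S - p') + (2 * (K - k) - S - p)) / 2 =
      K + N - k - l + P by omega,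
    ← Finset.sum_subset (by simpa using hKS) h1]
  refine Finset.sum_congr rfl fun s hs => ?_
  have hsK : s ≤ K := Nat.lt_succ_iff.mp (Finset.mem_range.mp hs)
  obtain ⟨j, rfl⟩ := Nat.exists_eq_add_of_le hsK
  rw [show s + j + 1 - 1 - s = j by omega]
  rcases lt_or_ge (N : ℤ) j with hj | hj
  · rw [balancedTerm, qFactInv_of_neg q (by omega : k - j < 0),
      qFactInv_of_neg q (by push_cast; omega : (s : ℤ) - ((s + j : ℕ) - k) < 0)]
    ring
  · have h3 := hrel j (by omega) (by omega)
    have h4 : (-1 : ℂ) ^ (s + j) * (-1) ^ j = (-1) ^ s := by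
      rw [pow_add, mul_assoc, ← mul_pow]; simp
    rw [hN] at h3
    rw [balancedTerm, zpow_natCast]
    push_cast at *
    rw [show (s : ℤ) + j + 1 - j = s + 1 by ring, show (S : ℤ) - (s + j) + j = S - s by ring] at h3
    rw [show (s : ℤ) - (s + j - l) = l - j by ring,
      show (s : ℤ) - (s + j - l - p') = l - j + p' by ring,
      show (s : ℤ) - (s + j - k) = k - j by ring,
      show (s : ℤ) - (s + j - k - p) = k - j + p by ring,
      show (s : ℤ) + j + N - k - l - s = N - k - l + j by ring,
      show (s : ℤ) + j + N - k - l + P - s = N - k - l + j + P by ring, ← h4]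
    linear_combination ((-1) ^ (s + j) * (-1) ^ j * (qFactInv q (l - j) * qFactInv q (l - j + p') *
      qFactInv q (k - j) * qFactInv q (k - j + p) * qFactInv q (N - k - l + j) *
      qFactInv q (N - k - l + j + P))) * h3

/-- The inverted relation `hrel` is applied at l and at l + p', and the two signs C cancel. -/
theorem symmetricWeight_eq {q : ℂ} {S K N : ℕ} {C : ℂ} {p p' P l : ℤ} (hC : C * C = 1)
    (hp : 0 ≤ p) (hp' : 0 ≤ p') (hP : 0 ≤ P) (hl : 0 ≤ l) (hlN : l ≤ N)
    (hN : 2 * (K : ℤ) - S = p + p' + P + 2 * N)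
    (hrel : ∀ j : ℤ, 0 ≤ j → j ≤ 2 * K - S → qFactZ q (K + 1 - j) * qFactInv q (S - K + j) =
      C * (qFactZ q (2 * K - S + 1 - j) * qFactInv q j)) :
    symmetricWeight q S p p' P (2 * (K - l) - S - p') = balancedWeight q N p' p P l := by
  have hrel' : ∀ j : ℤ, 0 ≤ j → j ≤ 2 * K - S → qFactInv q (K + 1 - j) * qFactZ q (S - K + j) =
      C * (qFactInv q (2 * K - S + 1 - j) * qFactZ q j) := fun j h0 h1 => by
    have h2 := congrArg (·⁻¹) (hrel j h0 h1)
    have h3 : C⁻¹ = C := inv_eq_of_mul_eq_one_left hC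
    simpa only [mul_inv, qFactInv, inv_inv, h3] using h2
  have h1 := hrel' l hl (by omega)
  have h2 := hrel' (l + p') (by omega) (by omega)
  rw [hN, show p + p' + P + 2 * (N : ℤ) = p' + p + P + 2 * N by ring] at h1 h2
  rw [symmetricWeight, balancedWeight,
    show ((S : ℤ) - p' - (2 * (K - l) - S - p')) / 2 = S - K + l by omega,
    show ((S : ℤ) + p' - (2 * (K - l) - S - p')) / 2 = S - K + (l + p') by omega,
    show (2 * ((K : ℤ) - l) - S - p' - P - p) / 2 = N - l by omega,
    show (2 * ((K : ℤ) - l) - S - p' - P + p) / 2 = N - l + p by omega,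
    show (2 * ((K : ℤ) - l) - S - p' + P - p) / 2 = N - l + P by omega,
    show (2 * ((K : ℤ) - l) - S - p' + P + p) / 2 = N - l + p + P by omega,
    show ((S : ℤ) + p' + (2 * (K - l) - S - p')) / 2 + 1 = K + 1 - l by omega,
    show ((S : ℤ) - p' + (2 * (K - l) - S - p')) / 2 + 1 = K + 1 - (l + p') by omega,
    show 2 * ((K : ℤ) - l) - S - p' + 1 = p + P + 2 * N + 1 - 2 * l by omega,
    show p + P + 2 * (N : ℤ) + 1 - l = p' + p + P + 2 * N + 1 - (l + p') by ring]
  generalize qFactZ q (S - K + l) = a1 at *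
  generalize qFactZ q (S - K + (l + p')) = a2 at *
  generalize qFactInv q (K + 1 - l) = a3 at *
  generalize qFactInv q (K + 1 - (l + p')) = a4 at *
  generalize qFactZ q l = a5 at *
  generalize qFactZ q (l + p') = a6 at *
  generalize qFactInv q (p' + p + P + 2 * N + 1 - l) = a7 at *
  generalize qFactInv q (p' + p + P + 2 * N + 1 - (l + p')) = a8 at *
  generalize qFactZ q (N - l) = b1
  generalize qFactZ q (N - l + p) = b2
  generalize qFactZ q (N - l + P) = b3
  generalize qFactZ q (N - l + p + P) = b4
  linear_combination (qBracket q (p + P + 2 * N + 1 - 2 * l) * (b1 * b2 * b3 * b4)) *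
    (a4 * a2 * h1 + C * (a7 * a5) * h2 + (a7 * a5) * (a8 * a6) * hC)

theorem sum_symmetricWeight_of_nonneg {q : ℂ} (hq : q ≠ 0) {S B : ℕ} {p p' P x x' : ℤ}
    (hp : 0 ≤ p) (hp' : 0 ≤ p') (hP : 0 ≤ P) (hpar : Even (S + p + p' + P))
    (hx : Even (S + p + x)) (hxS : x ≤ S - p) (hxP : p' + P ≤ x)
    (hxF : qFactZ q ((S + p + x) / 2 + 1) ≠ 0)
    (hx' : Even (S + p + x')) (hxS' : x' ≤ S - p) (hxP' : p' + P ≤ x')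
    (hxF' : qFactZ q ((S + p + x') / 2 + 1) ≠ 0) (hB : S - p' < B) :
    symmetricWeight q S p' p P x' * ∑ m ∈ Finset.range B, (if Even (S + p' + m) then
        symmetricWeight q S p p' P m * symmetricRacahSum q S p p' P m x *
          symmetricRacahSum q S p p' P m x' else 0) =
      if x = x' then 1 else 0 := by
  obtain ⟨K, C, hKS, hC, hK, hvan, hrel⟩ := exists_level hq S
  obtain ⟨a, ha⟩ := hx
  obtain ⟨a', ha'⟩ := hx'
  obtain ⟨b, hb⟩ := hpar
  have hle : ∀ n : ℤ, n ≤ S → qFactZ q (n + 1) ≠ 0 → n ≤ K := fun n h1 h2 => by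
    by_contra h3
    exact h2 (hvan n (by omega) h1)
  have haK := hle a (by omega) (by rwa [show (S + p + x) / 2 = a by omega] at hxF)
  have haK' := hle a' (by omega) (by rwa [show (S + p + x') / 2 = a' by omega] at hxF')
  obtain ⟨k, hk⟩ := Int.le.dest haK
  obtain ⟨k', hk'⟩ := Int.le.dest haK'
  obtain ⟨N, hN⟩ : ∃ N : ℕ, (N : ℤ) = k + (a - b) := ⟨(k + (a - b)).toNat, by omega⟩
  obtain rfl : x = 2 * (K - k) - S - p := by omega
  obtain rfl : x' = 2 * (K - k') - S - p := by omega
  have hN2 : 2 * (K : ℤ) - S = p + p' + P + 2 * N := by omega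
  have hN3 : 2 * (K : ℤ) - S = p' + p + P + 2 * N := by omega
  have hsum : ∑ l ∈ Finset.range (N + 1), balancedWeight q N p' p P l *
      balancedSum q N p p' P k l * balancedSum q N p p' P k' l =
      ∑ m ∈ Finset.range B, (if Even (S + p' + m) then
        symmetricWeight q S p p' P m * symmetricRacahSum q S p p' P m (2 * (K - k) - S - p) *
          symmetricRacahSum q S p p' P m (2 * (K - k') - S - p) else 0) := by
    have hcast : ∀ l ∈ Finset.range (N + 1),
        (((2 * ((K : ℤ) - l) - S - p').toNat : ℕ) : ℤ) = 2 * (K - l) - S - p' := fun l hl => by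
      have := Finset.mem_range.mp hl
      omega
    -- The index l corresponds to the label m = 2(K-l) - S - p'. Any other m of the right parity has
    -- weight 0: through a factorial of a negative number, or, when K < (S+p'+m)/2 ≤ S, through the
    -- reciprocal of a vanishing factorial, which is 0 by convention.
    refine Finset.sum_of_injOn (fun l : ℕ => (2 * ((K : ℤ) - l) - S - p').toNat) ?_ ?_ ?_ ?_
    · intro l hl l' hl' h
      have h1 := hcast l hl
      have h2 := hcast l' hl'
      simp only at h
      omega
    · intro l hl
      have h1 := hcast l hl
      simp only [Finset.coe_range, Set.mem_Iio]
      omega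
    · intro m hm hm'
      split_ifs with he
      · obtain ⟨c, hc⟩ := he
        have : symmetricWeight q S p p' P m = 0 := by
          rcases lt_or_ge (K : ℤ) c with h1 | h1
          · rcases le_or_gt c S with h2 | h2
            · rw [symmetricWeight, show (S + p' + m) / 2 = c by omega, qFactInv, qFactInv,
                hvan c h1 h2]
              simp
            · rw [symmetricWeight, qFactZ_of_neg q (by omega : (S - p' - m) / 2 < 0)]
              simp
          · rcases le_or_gt (K - c) N with h2 | h2
            · exfalso
              apply hm'
              refine ⟨(K - c).toNat, ?_, ?_⟩
              · simp only [Finset.coe_range, Set.mem_Iio]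
                omega
              · change (2 * ((K : ℤ) - ((K - c).toNat : ℕ)) - S - p').toNat = m
                omega
            · rw [symmetricWeight, qFactZ_of_neg q (by omega : (m - P - p) / 2 < 0)]
              simp
        rw [this, zero_mul, zero_mul]
      · rfl
    · intro l hl
      have hlN := Finset.mem_range.mp hl
      rw [hcast l hl, if_pos ⟨K - l, by ring⟩,
        symmetricWeight_eq hC hp hp' hP (by omega) (by omega) hN2 hrel,
        symmetricRacahSum_eq hKS hp hp' hP (by omega) hN2 hvan hrel,
        symmetricRacahSum_eq hKS hp hp' hP (by omega) hN2 hvan hrel]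
      have : ((-1 : ℂ) ^ K) * (-1) ^ K = 1 := by rw [← mul_pow]; simp
      linear_combination (-balancedWeight q N p' p P l * balancedSum q N p p' P k l *
        balancedSum q N p p' P k' l) * ((C * C) * this + hC)
  rw [← hsum, symmetricWeight_eq hC hp' hp hP (by omega) (by omega) hN3 hrel,
    sum_balancedWeight_mul hq hp hp' hP (by omega) (by omega)
      (by rw [← hN2]; exact qFactZ_ne_zero_mono (by omega) (by omega) hK)]
  refine if_congr ?_ rfl rfl
  omega

/-- A change of sign only exchanges two of the seven sums on which Racah's sum depends. Hence p, p'
and P may be replaced by their absolute values, although the spins themselves need not be so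
ordered. -/
theorem symmetricRacahSum_neg₁ (q : ℂ) (S : ℕ) (p p' P m x : ℤ) :
    symmetricRacahSum q S (-p) p' P m x = symmetricRacahSum q S p p' P m x := by
  refine Finset.sum_congr rfl fun s _ => ?_
  rw [sub_neg_eq_add, ← sub_eq_add_neg]
  ring

theorem symmetricRacahSum_neg₂ (q : ℂ) (S : ℕ) (p p' P m x : ℤ) :
    symmetricRacahSum q S p (-p') P m x = symmetricRacahSum q S p p' P m x := by
  refine Finset.sum_congr rfl fun s _ => ?_
  rw [sub_neg_eq_add, ← sub_eq_add_neg]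
  ring

theorem symmetricRacahSum_neg₃ (q : ℂ) (S : ℕ) (p p' P m x : ℤ) :
    symmetricRacahSum q S p p' (-P) m x = symmetricRacahSum q S p p' P m x := by
  refine Finset.sum_congr rfl fun s _ => ?_
  rw [sub_neg_eq_add, ← sub_eq_add_neg]
  ring

theorem symmetricWeight_neg₁ (q : ℂ) (S : ℕ) (p p' P m : ℤ) :
    symmetricWeight q S (-p) p' P m = symmetricWeight q S p p' P m := by
  simp only [symmetricWeight, sub_neg_eq_add, ← sub_eq_add_neg]
  ring

theorem symmetricWeight_neg₂ (q : ℂ) (S : ℕ) (p p' P m : ℤ) :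
    symmetricWeight q S p (-p') P m = symmetricWeight q S p p' P m := by
  simp only [symmetricWeight, sub_neg_eq_add, ← sub_eq_add_neg]
  ring

theorem symmetricWeight_neg₃ (q : ℂ) (S : ℕ) (p p' P m : ℤ) :
    symmetricWeight q S p p' (-P) m = symmetricWeight q S p p' P m := by
  simp only [symmetricWeight, sub_neg_eq_add, ← sub_eq_add_neg]
  ring

theorem symmetricRacahSum_abs (q : ℂ) (S : ℕ) (p p' P m x : ℤ) :
    symmetricRacahSum q S |p| |p'| |P| m x = symmetricRacahSum q S p p' P m x := by
  rcases abs_choice p with h | h <;> rcases abs_choice p' with h' | h' <;>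
    rcases abs_choice P with h'' | h'' <;>
    simp only [h, h', h'', symmetricRacahSum_neg₁, symmetricRacahSum_neg₂, symmetricRacahSum_neg₃]

theorem symmetricWeight_abs (q : ℂ) (S : ℕ) (p p' P m : ℤ) :
    symmetricWeight q S |p| |p'| |P| m = symmetricWeight q S p p' P m := by
  rcases abs_choice p with h | h <;> rcases abs_choice p' with h' | h' <;>
    rcases abs_choice P with h'' | h'' <;>
    simp only [h, h', h'', symmetricWeight_neg₁, symmetricWeight_neg₂, symmetricWeight_neg₃]

theorem sum_symmetricWeight {q : ℂ} (hq : q ≠ 0) {S B : ℕ} {p p' P x x' : ℤ}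
    (hpar : Even (S + p + p' + P))
    (hx : Even (S + p + x)) (hxS : x ≤ S - |p|) (hxP : |p'| + |P| ≤ x)
    (hxF : qFactZ q ((S + |p| + x) / 2 + 1) ≠ 0)
    (hx' : Even (S + p + x')) (hxS' : x' ≤ S - |p|) (hxP' : |p'| + |P| ≤ x')
    (hxF' : qFactZ q ((S + |p| + x') / 2 + 1) ≠ 0) (hB : S - |p'| < B) :
    symmetricWeight q S p' p P x' * ∑ m ∈ Finset.range B, (if Even (S + p' + m) then
        symmetricWeight q S p p' P m * symmetricRacahSum q S p p' P m x *
          symmetricRacahSum q S p p' P m x' else 0) =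
      if x = x' then 1 else 0 := by
  have h := sum_symmetricWeight_of_nonneg hq (abs_nonneg p) (abs_nonneg p') (abs_nonneg P)
    (by simpa [Int.even_add, even_abs] using hpar) (by simpa [Int.even_add, even_abs] using hx)
    hxS hxP hxF
    (by simpa [Int.even_add, even_abs] using hx') hxS' hxP' hxF' hB
  simpa only [symmetricRacahSum_abs, symmetricWeight_abs, Int.even_add, even_abs] using h

/-! ### Orthogonality of Racah's sums for spins. -/

/-- The square of `triangleCoeff`. -/
def triangleWeight (q : ℂ) (a b c : ℕ) : ℂ :=
  qFact q ((a + b - c) / 2) * qFact q ((a + c - b) / 2) * qFact q ((b + c - a) / 2) /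
    qFact q ((a + b + c) / 2 + 1)

theorem triangleCoeff_mul_self (q : ℂ) (a b c : ℕ) :
    triangleCoeff q a b c * triangleCoeff q a b c = triangleWeight q a b c := by
  rw [triangleCoeff, ← sq, ← Complex.cpow_nat_mul]
  simp [triangleWeight]

theorem Admissible.swap₁₂ {q : ℂ} {a b c : ℕ} (h : Admissible q a b c) : Admissible q b a c := by
  obtain ⟨h1, h2, h3, h4, h5⟩ := h
  rw [add_comm a b] at h1 h5
  exact ⟨h1, h3, h2, by omega, h5⟩

theorem Admissible.swap₂₃ {q : ℂ} {a b c : ℕ} (h : Admissible q a b c) : Admissible q a c b := by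
  obtain ⟨h1, h2, h3, h4, h5⟩ := h
  rw [add_right_comm] at h1 h5
  exact ⟨h1, by omega, h4, h3, h5⟩

theorem qFactInv_sub_natCast (q : ℂ) {m n : ℕ} (h : n ≤ m) :
    qFactInv q ((m : ℤ) - n) = (qFact q (m - n))⁻¹ := by
  rw [qFactInv, ← Nat.cast_sub h, qFactZ_natCast]

theorem racahSum_eq_symmetric {q : ℂ} {a b m c d x S : ℕ} {p p' P : ℤ}
    (hS : a + b + c + d = 2 * S) (hp : (a : ℤ) + d - b - c = 2 * p)
    (hp' : (a : ℤ) + b - c - d = 2 * p') (hP : (b : ℤ) + d - a - c = 2 * P)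
    (hm : Even (a + b + m)) (hx : Even (a + d + x)) :
    racahSum q a b m c d x = symmetricRacahSum q S p p' P m x := by
  obtain ⟨t1, h1⟩ : ∃ t, a + b + m = 2 * t := ⟨_, by rw [← Nat.two_mul_div_two_of_even hm]⟩
  obtain ⟨t2, h2⟩ : ∃ t, a + d + x = 2 * t := ⟨_, by rw [← Nat.two_mul_div_two_of_even hx]⟩
  obtain ⟨t3, h3⟩ : ∃ t, c + b + x = 2 * t := ⟨(c + b + x) / 2, by omega⟩
  obtain ⟨t4, h4⟩ : ∃ t, c + d + m = 2 * t := ⟨(c + d + m) / 2, by omega⟩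
  obtain ⟨u2, h5⟩ : ∃ t, a + m + c + x = 2 * t := ⟨(a + m + c + x) / 2, by omega⟩
  obtain ⟨u3, h6⟩ : ∃ t, b + m + d + x = 2 * t := ⟨(b + m + d + x) / 2, by omega⟩
  have e1 : ((S : ℤ) + p' + m) / 2 = t1 := by omega
  have e2 : ((S : ℤ) + p + x) / 2 = t2 := by omega
  have e3 : ((S : ℤ) - p + x) / 2 = t3 := by omega
  have e4 : ((S : ℤ) - p' + m) / 2 = t4 := by omega
  have e5 : ((S : ℤ) - P + m + x) / 2 = u2 := by omega
  have e6 : ((S : ℤ) + P + m + x) / 2 = u3 := by omega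
  rw [racahSum, symmetricRacahSum, e1, e2, e3, e4, e5, e6, hS, h1, h2, h3, h4, h5, h6]
  simp only [Nat.mul_div_cancel_left _ two_pos]
  clear e1 e2 e3 e4 e5 e6 h1 h2 h3 h4 h5 h6 hS hp hp' hP hm hx
  -- The bounds max T ≤ s ≤ min Q are dropped in favour of 0 ≤ s ≤ S, since outside them some
  -- reciprocal factorial has a negative argument.
  refine Finset.sum_subset_zero_on_sdiff ?_ ?_ ?_
  · intro s hs
    simp only [Finset.mem_Icc, Finset.mem_range, le_min_iff] at *
    omega
  · intro s hs
    simp only [Finset.mem_sdiff, Finset.mem_Icc, Finset.mem_range, le_min_iff, max_le_iff,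
      not_and_or, not_le] at hs
    obtain ⟨h0, ((h | h) | (h | h)) | (h | (h | h))⟩ := hs
    · rw [qFactInv_of_neg q (by omega : (s : ℤ) - t1 < 0)]; ring
    · rw [qFactInv_of_neg q (by omega : (s : ℤ) - t2 < 0)]; ring
    · rw [qFactInv_of_neg q (by omega : (s : ℤ) - t3 < 0)]; ring
    · rw [qFactInv_of_neg q (by omega : (s : ℤ) - t4 < 0)]; ring
    · omega
    · rw [qFactInv_of_neg q (by omega : (u2 : ℤ) - s < 0)]; ring
    · rw [qFactInv_of_neg q (by omega : (u3 : ℤ) - s < 0)]; ring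
  · intro s hs
    simp only [Finset.mem_Icc, le_min_iff, max_le_iff] at hs
    obtain ⟨⟨⟨g1, g2⟩, g3, g4⟩, g5, g6, g7⟩ := hs
    rw [qFactInv_sub_natCast q g1, qFactInv_sub_natCast q g2, qFactInv_sub_natCast q g3,
      qFactInv_sub_natCast q g4, qFactInv_sub_natCast q g5, qFactInv_sub_natCast q g6,
      qFactInv_sub_natCast q g7, show (s : ℤ) + 1 = (s + 1 : ℕ) by push_cast; ring, qFactZ_natCast,
      div_eq_mul_inv]
    simp only [mul_inv]
    ring

theorem qFactZ_eq_qFact (q : ℂ) {n : ℤ} {m : ℕ} (h : n = m) : qFactZ q n = qFact q m := by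
  rw [h, qFactZ_natCast]

theorem symmetricWeight_eq_triangleWeight {q : ℂ} {a b m c d S : ℕ} {p p' P : ℤ}
    (hS : a + b + c + d = 2 * S) (hp : (a : ℤ) + d - b - c = 2 * p)
    (hp' : (a : ℤ) + b - c - d = 2 * p') (hP : (b : ℤ) + d - a - c = 2 * P)
    (hab : Admissible q a b m) (hcd : Admissible q c d m) :
    symmetricWeight q S p p' P m =
      qInt q (m + 1) * triangleWeight q a b m * triangleWeight q c d m := by
  obtain ⟨⟨t, h1⟩, h2, h3, h4, -⟩ := hab
  obtain ⟨⟨t', h1'⟩, h2', h3', h4', -⟩ := hcd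
  rw [symmetricWeight, triangleWeight, triangleWeight, qFactInv, qFactInv,
    qFactZ_eq_qFact q (m := (c + d - m) / 2) (by omega),
    qFactZ_eq_qFact q (n := (S + p' - m) / 2) (m := (a + b - m) / 2) (by omega),
    qFactZ_eq_qFact q (n := (m - P - p) / 2) (m := (c + m - d) / 2) (by omega),
    qFactZ_eq_qFact q (n := (m - P + p) / 2) (m := (a + m - b) / 2) (by omega),
    qFactZ_eq_qFact q (n := (m + P - p) / 2) (m := (b + m - a) / 2) (by omega),
    qFactZ_eq_qFact q (n := (m + P + p) / 2) (m := (d + m - c) / 2) (by omega),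
    qFactZ_eq_qFact q (n := (S + p' + m) / 2 + 1) (m := (a + b + m) / 2 + 1) (by omega),
    qFactZ_eq_qFact q (n := (S - p' + m) / 2 + 1) (m := (c + d + m) / 2 + 1) (by omega),
    show (m : ℤ) + 1 = (m + 1 : ℕ) by push_cast; ring, qBracket_natCast]
  simp only [div_eq_mul_inv]
  ring

/-- A violated triangle inequality puts a negative argument into a factorial. A failure of
[j₁+j₂+j₃+1]! ≠ 0 makes a reciprocal factorial 0, by the convention 1/0 = 0. So the weight alone
enforces admissibility. -/
theorem symmetricWeight_eq_zero {q : ℂ} {a b m c d S : ℕ} {p p' P : ℤ}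
    (hS : a + b + c + d = 2 * S) (hp : (a : ℤ) + d - b - c = 2 * p)
    (hp' : (a : ℤ) + b - c - d = 2 * p') (hP : (b : ℤ) + d - a - c = 2 * P)
    (hm : Even (a + b + m)) (h : ¬(Admissible q a b m ∧ Admissible q c d m)) :
    symmetricWeight q S p p' P m = 0 := by
  obtain ⟨t, ht⟩ := hm
  by_contra h0
  have hz : ∀ n : ℤ, qFactZ q (n / 2) ≠ 0 → 0 ≤ n := fun n hn => by
    by_contra h1
    exact hn (qFactZ_of_neg q (by omega))
  simp only [symmetricWeight, mul_eq_zero, not_or, qFactInv, inv_eq_zero] at h0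
  obtain ⟨⟨-, ⟨⟨⟨⟨h1, h2⟩, h3⟩, h4⟩, h5⟩, h6⟩, h7, h8⟩ := h0
  rw [qFactZ_eq_qFact q (m := (a + b + m) / 2 + 1) (by omega)] at h7
  rw [qFactZ_eq_qFact q (m := (c + d + m) / 2 + 1) (by omega)] at h8
  replace h1 := hz _ h1
  replace h2 := hz _ h2
  replace h3 := hz _ h3
  replace h4 := hz _ h4
  replace h5 := hz _ h5
  replace h6 := hz _ h6
  exact h ⟨⟨⟨t, ht⟩, by omega, by omega, by omega, h7⟩,
    ⟨⟨S + t - a - b, by omega⟩, by omega, by omega, by omega, h8⟩⟩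

open Classical in
/-- Orthogonality of Racah's sums. -/
theorem sum_triangleWeight_mul_racahSum {q : ℂ} (hq : q ≠ 0) {a b c d x x' : ℕ}
    (h1 : Admissible q a d x) (h2 : Admissible q c b x) (h1' : Admissible q a d x')
    (h2' : Admissible q c b x') :
    qInt q (x' + 1) * triangleWeight q a d x' * triangleWeight q c b x' *
      ∑ m ∈ Finset.range (a + b + 1), (if Admissible q a b m ∧ Admissible q c d m then
        qInt q (m + 1) * triangleWeight q a b m * triangleWeight q c d m *
          racahSum q a b m c d x * racahSum q a b m c d x' else 0) =
      if x = x' then 1 else 0 := by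
  obtain ⟨g1, g2, g3, g4, g5⟩ := id h1
  obtain ⟨k1, k2, k3, k4, k5⟩ := id h2
  obtain ⟨g1', g2', g3', g4', g5'⟩ := id h1'
  obtain ⟨k1', k2', k3', k4', k5'⟩ := id h2'
  obtain ⟨v, hv⟩ := id g1
  obtain ⟨w, hw⟩ := id k1
  obtain ⟨v', hv'⟩ := id g1'
  obtain ⟨w', hw'⟩ := id k1'
  obtain ⟨S, hS⟩ : ∃ S, a + b + c + d = 2 * S := ⟨v + w - x, by omega⟩
  obtain ⟨p, hp⟩ : ∃ p : ℤ, (a : ℤ) + d - b - c = 2 * p := ⟨v - w, by omega⟩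
  obtain ⟨p', hp'⟩ : ∃ p : ℤ, (a : ℤ) + b - c - d = 2 * p := ⟨S - c - d, by omega⟩
  obtain ⟨P, hP⟩ : ∃ p : ℤ, (b : ℤ) + d - a - c = 2 * p := ⟨S - a - c, by omega⟩
  have hval : ∀ y : ℕ, Admissible q a d y → Admissible q c b y →
      Even ((S : ℤ) + p + y) ∧ (y : ℤ) ≤ S - |p| ∧ |p'| + |P| ≤ y ∧
        qFactZ q ((S + |p| + y) / 2 + 1) ≠ 0 := by
    rintro y ⟨⟨r, hr⟩, r2, r3, r4, r5⟩ ⟨⟨s, hs⟩, s2, s3, s4, s5⟩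
    refine ⟨⟨r, by omega⟩, ?_, ?_, ?_⟩
    · rcases abs_cases p with ⟨h, -⟩ | ⟨h, -⟩ <;> omega
    · rcases abs_cases p' with ⟨h, -⟩ | ⟨h, -⟩ <;> rcases abs_cases P with ⟨h', -⟩ | ⟨h', -⟩ <;>
        omega
    -- The sign of p decides which of the triples (a,d,y) and (c,b,y) has the larger sum; both are
    -- admissible.
    · rcases abs_choice p with h | h <;> rw [h]
      · rwa [qFactZ_eq_qFact q (m := (a + d + y) / 2 + 1) (by omega)]
      · rwa [qFactZ_eq_qFact q (m := (c + b + y) / 2 + 1) (by omega)]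
  obtain ⟨e1, e2, e3, e4⟩ := hval x h1 h2
  obtain ⟨e1', e2', e3', e4'⟩ := hval x' h1' h2'
  have key := sum_symmetricWeight hq (B := a + b + 1) (p' := p') (P := P)
    ⟨S - c, by omega⟩ e1 e2 e3 e4 e1' e2' e3' e4'
    (by have := neg_abs_le p'; push_cast; omega)
  rw [symmetricWeight_eq_triangleWeight (a := a) (b := d) (c := c) (d := b) (by omega) (by omega)
    (by omega) (by omega) h1' h2'] at key
  simp only [Nat.cast_inj] at key
  rw [← key]
  congr 1
  refine Finset.sum_congr rfl fun m _ => ?_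
  have hiff : Even ((S : ℤ) + p' + m) ↔ Even (a + b + m) := by
    rw [Int.even_iff, Nat.even_iff]
    omega
  simp only [hiff]
  by_cases hm : Even (a + b + m)
  · rw [if_pos hm, ← racahSum_eq_symmetric hS hp hp' hP hm g1,
      ← racahSum_eq_symmetric hS hp hp' hP hm g1']
    split_ifs with h
    · rw [symmetricWeight_eq_triangleWeight hS hp hp' hP h.1 h.2]
    · rw [symmetricWeight_eq_zero hS hp hp' hP hm h, zero_mul, zero_mul]
  · rw [if_neg hm, if_neg fun h => hm h.1.1]

/-! ### Tetrahedral symmetries of the 6j-symbols. -/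

/-- Racah's sum as a function of the sums over triples and quadrilaterals. -/
def racahSumOf (q : ℂ) (t₁ t₂ t₃ t₄ u₁ u₂ u₃ : ℕ) : ℂ :=
  ∑ s ∈ Finset.Icc (max (max t₁ t₂) (max t₃ t₄)) (min u₁ (min u₂ u₃)),
    (-1) ^ s * qFact q (s + 1) /
      ((qFact q (s - t₁) * qFact q (s - t₂) * qFact q (s - t₃) * qFact q (s - t₄)) *
        (qFact q (u₁ - s) * qFact q (u₂ - s) * qFact q (u₃ - s)))

theorem racahSum_eq (q : ℂ) (a b c d e f : ℕ) :
    racahSum q a b c d e f = racahSumOf q ((a + b + c) / 2) ((a + e + f) / 2) ((d + b + f) / 2)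
      ((d + e + c) / 2) ((a + b + d + e) / 2) ((a + c + d + f) / 2) ((b + c + e + f) / 2) := rfl

theorem racahSumOf_swap_t₁₂ (q : ℂ) (t₁ t₂ t₃ t₄ u₁ u₂ u₃ : ℕ) :
    racahSumOf q t₁ t₂ t₃ t₄ u₁ u₂ u₃ = racahSumOf q t₂ t₁ t₃ t₄ u₁ u₂ u₃ := by
  rw [racahSumOf, racahSumOf, max_comm t₁]
  refine Finset.sum_congr rfl fun s _ => ?_
  congr 1
  ring

theorem racahSumOf_swap_t₂₃ (q : ℂ) (t₁ t₂ t₃ t₄ u₁ u₂ u₃ : ℕ) :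
    racahSumOf q t₁ t₂ t₃ t₄ u₁ u₂ u₃ = racahSumOf q t₁ t₃ t₂ t₄ u₁ u₂ u₃ := by
  rw [racahSumOf, racahSumOf, max_max_max_comm]
  refine Finset.sum_congr rfl fun s _ => ?_
  congr 1
  ring

theorem racahSumOf_swap_t₃₄ (q : ℂ) (t₁ t₂ t₃ t₄ u₁ u₂ u₃ : ℕ) :
    racahSumOf q t₁ t₂ t₃ t₄ u₁ u₂ u₃ = racahSumOf q t₁ t₂ t₄ t₃ u₁ u₂ u₃ := by
  rw [racahSumOf, racahSumOf, max_comm t₃]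
  refine Finset.sum_congr rfl fun s _ => ?_
  congr 1
  ring

theorem racahSumOf_swap_u₁₂ (q : ℂ) (t₁ t₂ t₃ t₄ u₁ u₂ u₃ : ℕ) :
    racahSumOf q t₁ t₂ t₃ t₄ u₁ u₂ u₃ = racahSumOf q t₁ t₂ t₃ t₄ u₂ u₁ u₃ := by
  rw [racahSumOf, racahSumOf, min_left_comm]
  refine Finset.sum_congr rfl fun s _ => ?_
  congr 1
  ring

theorem racahSumOf_swap_u₂₃ (q : ℂ) (t₁ t₂ t₃ t₄ u₁ u₂ u₃ : ℕ) :
    racahSumOf q t₁ t₂ t₃ t₄ u₁ u₂ u₃ = racahSumOf q t₁ t₂ t₃ t₄ u₁ u₃ u₂ := by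
  rw [racahSumOf, racahSumOf, min_comm u₂]
  refine Finset.sum_congr rfl fun s _ => ?_
  congr 1
  ring

theorem racahSum_swap_columns₁₂ (q : ℂ) (a b c d e f : ℕ) :
    racahSum q a b c d e f = racahSum q b a c e d f := by
  rw [racahSum_eq, racahSum_eq, racahSumOf_swap_t₂₃, racahSumOf_swap_u₂₃]
  congr 2 <;> omega

theorem racahSum_swap_columns₂₃ (q : ℂ) (a b c d e f : ℕ) :
    racahSum q a b c d e f = racahSum q a c b d f e := by
  rw [racahSum_eq, racahSum_eq, racahSumOf_swap_t₃₄, racahSumOf_swap_u₁₂]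
  congr 2 <;> omega

theorem racahSum_swap_rows (q : ℂ) (a b c d e f : ℕ) :
    racahSum q a b c d e f = racahSum q a e f d b c := by
  rw [racahSum_eq, racahSum_eq, racahSumOf_swap_t₁₂, racahSumOf_swap_t₃₄]
  congr 2 <;> omega

theorem TetAdmissible.swap_columns₁₂ {q : ℂ} {a b c d e f : ℕ} (h : TetAdmissible q a b c d e f) :
    TetAdmissible q b a c e d f :=
  ⟨h.1.swap₁₂, h.2.2.1.swap₁₂, h.2.1.swap₁₂, h.2.2.2.swap₁₂⟩

theorem TetAdmissible.swap_columns₂₃ {q : ℂ} {a b c d e f : ℕ} (h : TetAdmissible q a b c d e f) :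
    TetAdmissible q a c b d f e :=
  ⟨h.1.swap₂₃, h.2.1.swap₂₃, h.2.2.2.swap₂₃, h.2.2.1.swap₂₃⟩

theorem TetAdmissible.swap_rows {q : ℂ} {a b c d e f : ℕ} (h : TetAdmissible q a b c d e f) :
    TetAdmissible q a e f d b c :=
  ⟨h.2.1, h.1, h.2.2.2, h.2.2.1⟩

theorem triangleCoeff_swap₁₂ (q : ℂ) (a b c : ℕ) :
    triangleCoeff q a b c = triangleCoeff q b a c := by
  rw [triangleCoeff, triangleCoeff, add_comm b a]
  congr 2
  ring

theorem triangleCoeff_swap₂₃ (q : ℂ) (a b c : ℕ) :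
    triangleCoeff q a b c = triangleCoeff q a c b := by
  rw [triangleCoeff, triangleCoeff, add_comm c b, add_right_comm a c b]
  congr 2
  ring

theorem thetaNet_swap₁₂ (q : ℂ) (a b c : ℕ) : thetaNet q a b c = thetaNet q b a c := by
  rw [thetaNet, thetaNet, add_comm b a]
  congr 1 <;> ring

theorem thetaNet_swap₂₃ (q : ℂ) (a b c : ℕ) : thetaNet q a b c = thetaNet q a c b := by
  rw [thetaNet, thetaNet, add_comm c b, add_right_comm a c b]
  congr 1 <;> ring

theorem tetNet_swap_columns₁₂ (q : ℂ) (a b c d e f : ℕ) :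
    tetNet q a b c d e f = tetNet q b a c e d f := by
  rw [tetNet, tetNet, racahSum_swap_columns₁₂]
  simp only [Fin.prod_univ_three, Fin.prod_univ_four, Matrix.cons_val]
  rw [add_comm b a, add_right_comm (a + b) e d, add_comm e a, add_comm e d]
  congr 2 <;> ring_nf

theorem tetNet_swap_columns₂₃ (q : ℂ) (a b c d e f : ℕ) :
    tetNet q a b c d e f = tetNet q a c b d f e := by
  rw [tetNet, tetNet, racahSum_swap_columns₂₃]
  simp only [Fin.prod_univ_three, Fin.prod_univ_four, Matrix.cons_val]
  rw [add_right_comm a c b, add_right_comm a f e, add_right_comm d c e, add_right_comm d f b,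
    add_right_comm (c + b) f e, add_comm c b]
  congr 2 <;> ring

theorem tetNet_swap_rows (q : ℂ) (a b c d e f : ℕ) :
    tetNet q a b c d e f = tetNet q a e f d b c := by
  rw [tetNet, tetNet, racahSum_swap_rows]
  simp only [Fin.prod_univ_three, Fin.prod_univ_four, Matrix.cons_val]
  rw [show a + e + d + b = a + b + d + e by ring, show a + f + d + c = a + c + d + f by ring,
    show e + f + b + c = b + c + e + f by ring]
  congr 2 <;> ring

theorem racahSixJ_swap_columns₁₂ (q : ℂ) (a b c d e f : ℕ) :
    racahSixJ q a b c d e f = racahSixJ q b a c e d f := by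
  rw [racahSixJ, racahSixJ, racahSum_swap_columns₁₂, triangleCoeff_swap₁₂ q a b c,
    triangleCoeff_swap₁₂ q a e f, triangleCoeff_swap₁₂ q d b f, triangleCoeff_swap₁₂ q d e c]
  classical
  refine if_congr ⟨fun h => h.swap_columns₁₂, fun h => h.swap_columns₁₂⟩ ?_ rfl
  ring

theorem racahSixJ_swap_columns₂₃ (q : ℂ) (a b c d e f : ℕ) :
    racahSixJ q a b c d e f = racahSixJ q a c b d f e := by
  rw [racahSixJ, racahSixJ, racahSum_swap_columns₂₃, triangleCoeff_swap₂₃ q a b c,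
    triangleCoeff_swap₂₃ q a e f, triangleCoeff_swap₂₃ q d b f, triangleCoeff_swap₂₃ q d e c]
  classical
  refine if_congr ⟨fun h => h.swap_columns₂₃, fun h => h.swap_columns₂₃⟩ ?_ rfl
  ring

theorem racahSixJ_swap_rows (q : ℂ) (a b c d e f : ℕ) :
    racahSixJ q a b c d e f = racahSixJ q a e f d b c := by
  rw [racahSixJ, racahSixJ, racahSum_swap_rows]
  classical
  refine if_congr ⟨fun h => h.swap_rows, fun h => h.swap_rows⟩ ?_ rfl
  ring

theorem netSixJ_swap_columns₁₂ (q : ℂ) (a b c d e f : ℕ) :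
    netSixJ q a b c d e f = netSixJ q b a c e d f := by
  rw [netSixJ, netSixJ, tetNet_swap_columns₁₂, thetaNet_swap₁₂ q a b c,
    thetaNet_swap₁₂ q a e f, thetaNet_swap₁₂ q d b f, thetaNet_swap₁₂ q d e c]
  classical
  refine if_congr ⟨fun h => h.swap_columns₁₂, fun h => h.swap_columns₁₂⟩ ?_ rfl
  congr 1
  ring

theorem netSixJ_swap_columns₂₃ (q : ℂ) (a b c d e f : ℕ) :
    netSixJ q a b c d e f = netSixJ q a c b d f e := by
  rw [netSixJ, netSixJ, tetNet_swap_columns₂₃, thetaNet_swap₂₃ q a b c,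
    thetaNet_swap₂₃ q a e f, thetaNet_swap₂₃ q d b f, thetaNet_swap₂₃ q d e c]
  classical
  refine if_congr ⟨fun h => h.swap_columns₂₃, fun h => h.swap_columns₂₃⟩ ?_ rfl
  congr 1
  ring

theorem netSixJ_swap_rows (q : ℂ) (a b c d e f : ℕ) :
    netSixJ q a b c d e f = netSixJ q a e f d b c := by
  rw [netSixJ, netSixJ, tetNet_swap_rows]
  classical
  refine if_congr ⟨fun h => h.swap_rows, fun h => h.swap_rows⟩ ?_ rfl
  congr 1
  ring

/-! ### Orthogonality of the two normalized 6j-symbols. -/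

theorem triangleWeight_ne_zero {q : ℂ} {a b c : ℕ} (h : Admissible q a b c) :
    triangleWeight q a b c ≠ 0 := by
  obtain ⟨h1, h2, h3, h4, h5⟩ := h
  exact div_ne_zero (mul_ne_zero (mul_ne_zero (qFact_ne_zero_mono (by omega) h5)
    (qFact_ne_zero_mono (by omega) h5)) (qFact_ne_zero_mono (by omega) h5)) h5

theorem qInt_ne_zero_of_admissible {q : ℂ} {a b c : ℕ} (h : Admissible q a b c) :
    qInt q (c + 1) ≠ 0 := by
  obtain ⟨h1, h2, h3, h4, h5⟩ := h
  have := qFact_ne_zero_mono (m := c + 1) (by omega) h5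
  rw [qFact_succ] at this
  exact right_ne_zero_of_mul this

/-- Orthogonality of a normalization of Racah's sums, `ω` being the weight of a spin. -/
theorem sum_mul_sixJ_of_normalization {q : ℂ} (hq : q ≠ 0) {a b c d x x' : ℕ}
    (h1 : Admissible q a d x) (h2 : Admissible q c b x) (h1' : Admissible q a d x')
    (h2' : Admissible q c b x') {J : ℕ → ℕ → ℂ} {ω g : ℕ → ℂ} {σ : ℂ}
    (h0 : ∀ m, ¬(Admissible q a b m ∧ Admissible q c d m) → J m x = 0)
    (hJ : ∀ m, Admissible q a b m → Admissible q c d m → ω m * J m x * J m x' = σ * g x * g x' *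
      (qInt q (m + 1) * triangleWeight q a b m * triangleWeight q c d m *
        racahSum q a b m c d x * racahSum q a b m c d x'))
    (hg : ω x' * (σ * g x' * g x') =
      qInt q (x' + 1) * triangleWeight q a d x' * triangleWeight q c b x') :
    ω x' * ∑ m ∈ Finset.range (a + b + 1), ω m * J m x * J m x' = if x = x' then 1 else 0 := by
  classical
  have key := sum_triangleWeight_mul_racahSum hq h1 h2 h1' h2'
  have hsum : ∑ m ∈ Finset.range (a + b + 1), ω m * J m x * J m x' = σ * g x * g x' *
      ∑ m ∈ Finset.range (a + b + 1), (if Admissible q a b m ∧ Admissible q c d m then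
        qInt q (m + 1) * triangleWeight q a b m * triangleWeight q c d m *
          racahSum q a b m c d x * racahSum q a b m c d x' else 0) := by
    rw [Finset.mul_sum]
    refine Finset.sum_congr rfl fun m _ => ?_
    split_ifs with h
    · exact hJ m h.1 h.2
    · rw [h0 m h]; ring
  rw [hsum]
  split_ifs with h
  · subst h
    rw [if_pos rfl, ← hg] at key
    rw [← mul_assoc, key]
  · rw [if_neg h] at key
    -- For x ≠ x' the factor g x · g x' need not simplify, but the unnormalized sum is itself 0.
    have := (mul_eq_zero.mp key).resolve_left (mul_ne_zero (mul_ne_zero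
      (qInt_ne_zero_of_admissible h1') (triangleWeight_ne_zero h1')) (triangleWeight_ne_zero h2'))
    rw [this]
    ring

theorem sum_mul_racahSixJ {q : ℂ} (hq : q ≠ 0) {a b c d x x' : ℕ}
    (h1 : Admissible q a d x) (h2 : Admissible q c b x) (h1' : Admissible q a d x')
    (h2' : Admissible q c b x') :
    qInt q (x' + 1) * ∑ m ∈ Finset.range (a + b + 1),
        qInt q (m + 1) * racahSixJ q a b m c d x * racahSixJ q a b m c d x' =
      if x = x' then 1 else 0 := by
  refine sum_mul_sixJ_of_normalization hq h1 h2 h1' h2' (J := fun m x => racahSixJ q a b m c d x)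
    (ω := fun m => qInt q (m + 1)) (σ := 1)
    (g := fun y => triangleCoeff q a d y * triangleCoeff q c b y) ?_ ?_ ?_
  · exact fun m h => if_neg fun h' => h ⟨h'.1, h'.2.2.2⟩
  · intro m hm hm'
    rw [racahSixJ, racahSixJ, if_pos ⟨hm, h1, h2, hm'⟩, if_pos ⟨hm, h1', h2', hm'⟩,
      ← triangleCoeff_mul_self, ← triangleCoeff_mul_self]
    ring
  · rw [← triangleCoeff_mul_self, ← triangleCoeff_mul_self]
    ring

/-- The product of the three quantum factorials of the internal edges of a vertex. -/
def triangleProduct (q : ℂ) (a b c : ℕ) : ℂ :=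
  qFact q ((a + b - c) / 2) * qFact q ((a + c - b) / 2) * qFact q ((b + c - a) / 2)

/-- The twelve differences Qⱼ - Tᵢ are exactly the twelve combinations j + j' - j'' belonging to the
four vertices, three for each. -/
theorem tetNet_eq_triangleProduct {q : ℂ} {a b c d e f : ℕ} (h : TetAdmissible q a b c d e f) :
    tetNet q a b c d e f = triangleProduct q a b c * triangleProduct q a e f *
      triangleProduct q d b f * triangleProduct q d e c /
      (qFact q a * qFact q b * qFact q c * qFact q d * qFact q e * qFact q f) *
      racahSum q a b c d e f := by
  obtain ⟨⟨⟨t1, h1⟩, -⟩, ⟨⟨t2, h2⟩, -⟩, ⟨⟨t3, h3⟩, -⟩, ⟨⟨t4, h4⟩, -⟩⟩ := h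
  rw [tetNet]
  simp only [Fin.prod_univ_three, Fin.prod_univ_four, Matrix.cons_val, triangleProduct]
  rw [show (a + b + d + e) / 2 - (a + b + c) / 2 = (d + e - c) / 2 by omega,
    show (a + b + d + e) / 2 - (a + e + f) / 2 = (d + b - f) / 2 by omega,
    show (a + b + d + e) / 2 - (d + b + f) / 2 = (a + e - f) / 2 by omega,
    show (a + b + d + e) / 2 - (d + e + c) / 2 = (a + b - c) / 2 by omega,
    show (a + c + d + f) / 2 - (a + b + c) / 2 = (d + f - b) / 2 by omega,
    show (a + c + d + f) / 2 - (a + e + f) / 2 = (d + c - e) / 2 by omega,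
    show (a + c + d + f) / 2 - (d + b + f) / 2 = (a + c - b) / 2 by omega,
    show (a + c + d + f) / 2 - (d + e + c) / 2 = (a + f - e) / 2 by omega,
    show (b + c + e + f) / 2 - (a + b + c) / 2 = (e + f - a) / 2 by omega,
    show (b + c + e + f) / 2 - (a + e + f) / 2 = (b + c - a) / 2 by omega,
    show (b + c + e + f) / 2 - (d + b + f) / 2 = (e + c - d) / 2 by omega,
    show (b + c + e + f) / 2 - (d + e + c) / 2 = (b + f - d) / 2 by omega]
  congr 2
  ring

theorem thetaNet_sqrt_mul_self (q : ℂ) (a b c : ℕ) :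
    thetaNet q a b c ^ (1 / 2 : ℂ) * thetaNet q a b c ^ (1 / 2 : ℂ) = (-1) ^ ((a + b + c) / 2) *
      (qFact q ((a + b + c) / 2 + 1) * triangleProduct q a b c) /
        (qFact q a * qFact q b * qFact q c) := by
  rw [← sq, ← Complex.cpow_nat_mul]
  simp [thetaNet, triangleProduct]
  ring

/-- The roots of theta nets containing m occur squared, so no choice of branch matters; those
containing x or x' leave the sum inside g. What is left is the Racah–Wigner weight up to a sign,
because the signs of the theta nets cancel the sign of the loop value up to (-1)^S, which σ records.
-/
theorem sum_mul_netSixJ {q : ℂ} (hq : q ≠ 0) {a b c d x x' : ℕ}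
    (h1 : Admissible q a d x) (h2 : Admissible q c b x) (h1' : Admissible q a d x')
    (h2' : Admissible q c b x') :
    loopValue q x' * ∑ m ∈ Finset.range (a + b + 1),
        loopValue q m * netSixJ q a b m c d x * netSixJ q a b m c d x' =
      if x = x' then 1 else 0 := by
  have hne : ∀ {i j k : ℕ}, Admissible q i j k → qFact q i ≠ 0 ∧ qFact q j ≠ 0 ∧ qFact q k ≠ 0 ∧
      triangleProduct q i j k ≠ 0 := by
    rintro i j k ⟨g1, g2, g3, g4, g5⟩
    exact ⟨qFact_ne_zero_mono (by omega) g5, qFact_ne_zero_mono (by omega) g5,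
      qFact_ne_zero_mono (by omega) g5, mul_ne_zero (mul_ne_zero (qFact_ne_zero_mono (by omega) g5)
        (qFact_ne_zero_mono (by omega) g5)) (qFact_ne_zero_mono (by omega) g5)⟩
  have hF : ∀ {i j k : ℕ}, Admissible q i j k → qFact q ((i + j + k) / 2 + 1) ≠ 0 :=
    fun h => h.2.2.2.2
  have hs : ∀ {i j k : ℕ}, Admissible q i j k → thetaNet q i j k ^ (1 / 2 : ℂ) ≠ 0 := by
    intro i j k h h0
    have := thetaNet_sqrt_mul_self q i j k
    rw [h0, zero_mul, eq_comm, div_eq_zero_iff] at this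
    obtain ⟨f1, f2, f3, f4⟩ := hne h
    rcases this with h' | h'
    · exact mul_ne_zero (pow_ne_zero _ (by norm_num)) (mul_ne_zero (hF h) f4) h'
    · exact mul_ne_zero (mul_ne_zero f1 f2) f3 h'
  have hT : ∀ i j k, triangleWeight q i j k =
    triangleProduct q i j k / qFact q ((i + j + k) / 2 + 1) := fun _ _ _ => rfl
  obtain ⟨S, hS⟩ : ∃ S, a + b + c + d = 2 * S := by
    obtain ⟨⟨t, ht⟩, -⟩ := h1
    obtain ⟨⟨t', ht'⟩, -⟩ := h2
    exact ⟨t + t' - x, by omega⟩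
  obtain ⟨fa, fd, fx, -⟩ := hne h1
  obtain ⟨fc, fb, -, -⟩ := hne h2
  obtain ⟨-, -, fx', f1⟩ := hne h1'
  obtain ⟨-, -, -, f2⟩ := hne h2'
  have hneg : ∀ n : ℕ, ((-1 : ℂ) ^ n) * (-1) ^ n = 1 := fun n => by rw [← mul_pow]; simp
  refine sum_mul_sixJ_of_normalization hq h1 h2 h1' h2' (J := fun m x => netSixJ q a b m c d x)
    (ω := loopValue q) (σ := (-1) ^ S / (qFact q a * qFact q b * qFact q c * qFact q d))
    (g := fun y => triangleProduct q a d y * triangleProduct q c b y /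
      (qFact q y * (thetaNet q a d y ^ (1 / 2 : ℂ) * thetaNet q c b y ^ (1 / 2 : ℂ)))) ?_ ?_ ?_
  · exact fun m h => if_neg fun h' => h ⟨h'.1, h'.2.2.2⟩
  · intro m hm hm'
    have t : TetAdmissible q a b m c d x := ⟨hm, h1, h2, hm'⟩
    have t' : TetAdmissible q a b m c d x' := ⟨hm, h1', h2', hm'⟩
    have e1 := thetaNet_sqrt_mul_self q a b m
    have e2 := thetaNet_sqrt_mul_self q c d m
    have g1 := hs hm
    have g2 := hs hm'
    have g3 := hF hm
    have g4 := hF hm'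
    obtain ⟨-, -, fm, f3⟩ := hne hm
    obtain ⟨-, -, -, f4⟩ := hne hm'
    -- The sums of the triples (a,b,m) and (c,d,m) add up to S + m, with S half the total of the
    -- labels a, b, c, d.
    have hsgn : ((-1 : ℂ) ^ m) =
        (-1) ^ S * ((-1) ^ ((a + b + m) / 2) * (-1) ^ ((c + d + m) / 2)) := by
      obtain ⟨⟨t, ht⟩, -⟩ := hm
      obtain ⟨⟨t', ht'⟩, -⟩ := hm'
      rw [← pow_add, ← pow_add, show S + ((a + b + m) / 2 + (c + d + m) / 2) = m + (S + S) by omega,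
        pow_add, pow_add, hneg, mul_one]
    rw [netSixJ, netSixJ, if_pos t, if_pos t', tetNet_eq_triangleProduct t,
      tetNet_eq_triangleProduct t', loopValue, hT, hT]
    have e3 : (thetaNet q a b m ^ (1 / 2 : ℂ) * thetaNet q c d m ^ (1 / 2 : ℂ))⁻¹ *
        (thetaNet q a b m ^ (1 / 2 : ℂ) * thetaNet q c d m ^ (1 / 2 : ℂ))⁻¹ * (-1) ^ m =
        (-1) ^ S * (qFact q a * qFact q b * qFact q c * qFact q d * qFact q m * qFact q m) /
        (qFact q ((a + b + m) / 2 + 1) * triangleProduct q a b m *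
          (qFact q ((c + d + m) / 2 + 1) * triangleProduct q c d m)) := by
      rw [← mul_inv, mul_mul_mul_comm, e1, e2, hsgn]
      have n1 : ((-1 : ℂ) ^ ((a + b + m) / 2)) ≠ 0 := pow_ne_zero _ (by norm_num)
      have n2 : ((-1 : ℂ) ^ ((c + d + m) / 2)) ≠ 0 := pow_ne_zero _ (by norm_num)
      field_simp
    calc _ = ((thetaNet q a b m ^ (1 / 2 : ℂ) * thetaNet q c d m ^ (1 / 2 : ℂ))⁻¹ *
        (thetaNet q a b m ^ (1 / 2 : ℂ) * thetaNet q c d m ^ (1 / 2 : ℂ))⁻¹ * (-1) ^ m) *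
        (qInt q (m + 1) * (triangleProduct q a b m * triangleProduct q c d m) ^ 2 /
          (qFact q a * qFact q b * qFact q c * qFact q d * qFact q m) ^ 2 *
          (triangleProduct q a d x * triangleProduct q c b x /
            (qFact q x * (thetaNet q a d x ^ (1 / 2 : ℂ) * thetaNet q c b x ^ (1 / 2 : ℂ)))) *
          (triangleProduct q a d x' * triangleProduct q c b x' /
            (qFact q x' * (thetaNet q a d x' ^ (1 / 2 : ℂ) * thetaNet q c b x' ^ (1 / 2 : ℂ)))) *
          racahSum q a b m c d x * racahSum q a b m c d x') := by
          simp only [div_eq_mul_inv, mul_inv]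
          ring
      _ = _ := by
          rw [e3]
          generalize triangleProduct q a d x * triangleProduct q c b x /
            (qFact q x * (thetaNet q a d x ^ (1 / 2 : ℂ) * thetaNet q c b x ^ (1 / 2 : ℂ))) = y1
          generalize triangleProduct q a d x' * triangleProduct q c b x' /
            (qFact q x' * (thetaNet q a d x' ^ (1 / 2 : ℂ) * thetaNet q c b x' ^ (1 / 2 : ℂ))) = y2
          field_simp
  · have e1 := thetaNet_sqrt_mul_self q a d x'
    have e2 := thetaNet_sqrt_mul_self q c b x'
    have g3 := hF h1'
    have g4 := hF h2'
    have hsgn : ((-1 : ℂ) ^ x') * (-1) ^ S *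
        ((-1) ^ ((a + d + x') / 2) * (-1) ^ ((c + b + x') / 2))⁻¹ = 1 := by
      obtain ⟨⟨t, ht⟩, -⟩ := h1'
      obtain ⟨⟨t', ht'⟩, -⟩ := h2'
      rw [← pow_add, ← pow_add, show (a + d + x') / 2 + (c + b + x') / 2 = x' + S by omega]
      exact mul_inv_cancel₀ (pow_ne_zero _ (by norm_num))
    have e3 : (thetaNet q a d x' ^ (1 / 2 : ℂ) * thetaNet q c b x' ^ (1 / 2 : ℂ)) *
        (thetaNet q a d x' ^ (1 / 2 : ℂ) * thetaNet q c b x' ^ (1 / 2 : ℂ)) =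
        (-1) ^ ((a + d + x') / 2) * (-1) ^ ((c + b + x') / 2) *
          (qFact q ((a + d + x') / 2 + 1) * triangleProduct q a d x' *
            (qFact q ((c + b + x') / 2 + 1) * triangleProduct q c b x')) /
          (qFact q a * qFact q b * qFact q c * qFact q d * qFact q x' * qFact q x') := by
      rw [mul_mul_mul_comm, e1, e2]
      field_simp
    calc _ = (-1) ^ x' * (-1) ^ S * (qInt q (x' + 1) *
          (triangleProduct q a d x' * triangleProduct q c b x') ^ 2 /
          (qFact q a * qFact q b * qFact q c * qFact q d * qFact q x' ^ 2)) *
          ((thetaNet q a d x' ^ (1 / 2 : ℂ) * thetaNet q c b x' ^ (1 / 2 : ℂ)) *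
          (thetaNet q a d x' ^ (1 / 2 : ℂ) * thetaNet q c b x' ^ (1 / 2 : ℂ)))⁻¹ := by
          rw [loopValue]
          simp only [div_eq_mul_inv, mul_inv]
          ring
      _ = ((-1 : ℂ) ^ x') * (-1) ^ S * ((-1) ^ ((a + d + x') / 2) * (-1) ^ ((c + b + x') / 2))⁻¹ *
          (qInt q (x' + 1) * triangleWeight q a d x' * triangleWeight q c b x') := by
          rw [e3, hT, hT]
          have n1 : ((-1 : ℂ) ^ ((a + d + x') / 2)) ≠ 0 := pow_ne_zero _ (by norm_num)
          have n2 : ((-1 : ℂ) ^ ((c + b + x') / 2)) ≠ 0 := pow_ne_zero _ (by norm_num)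
          field_simp
      _ = _ := by rw [hsgn, one_mul]

/-! ### Inversion of the toroidal symbol. -/

/-- The inversion of the toroidal symbol, for any orthogonal normalization `J` of the
`6j`-symbols, `ω` being the weight of a spin. -/
theorem sum_toroidalSymbol_mul {q : ℂ} (A : ℂ) {J : ℕ → ℕ → ℕ → ℕ → ℕ → ℕ → ℂ} {ω τ : ℕ → ℂ}
    (hJ : ∀ a b c d e f, ¬TetAdmissible q a b c d e f → J a b c d e f = 0)
    (h₁₂ : ∀ a b c d e f, J a b c d e f = J b a c e d f)
    (h₂₃ : ∀ a b c d e f, J a b c d e f = J a c b d f e)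
    (hrows : ∀ a b c d e f, J a b c d e f = J a e f d b c)
    (hτ : ∀ x, loopValue q x = τ x * ω x)
    (horth : ∀ a b c d x x', Admissible q a d x → Admissible q c b x → Admissible q a d x' →
      Admissible q c b x' → ω x' * ∑ m ∈ Finset.range (a + b + 1),
        ω m * J a b m c d x * J a b m c d x' = if x = x' then 1 else 0)
    (j₁ j₂ j₃ j₄ j₅ j₆ j₈ j₉ l : ℕ) :
    ∑ m ∈ Finset.range (j₁ + j₄ + 1),
        ω m * toroidalSymbol J q A j₁ j₂ j₃ j₄ j₅ j₆ m j₈ j₉ * J j₁ j₄ m j₈ j₉ l =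
      τ l * twist A j₂ j₆ l * J j₂ j₅ j₈ j₄ l j₆ * J j₃ j₆ j₉ l j₁ j₂ := by
  have e1 : ∀ m x, J m j₈ j₉ x j₁ j₄ = J j₁ j₄ m j₈ j₉ x := fun m x => by
    rw [hrows, h₁₂, h₂₃]
  have e2 : J j₂ j₅ j₈ j₄ l j₆ = J j₄ j₅ j₆ j₂ l j₈ := by
    rw [h₁₂, hrows, h₁₂]
  have e3 : J j₃ j₆ j₉ l j₁ j₂ = J j₁ j₂ j₃ j₆ j₉ l := by
    rw [hrows, h₁₂, h₂₃]
  rw [e2, e3]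
  -- Orthogonality needs these two triples to be admissible. Otherwise J j₁ j₄ m j₈ j₉ l vanishes
  -- for every m, and so does one of the symbols on the right.
  by_cases hadm : Admissible q j₁ j₉ l ∧ Admissible q j₈ j₄ l
  · obtain ⟨ha, hb⟩ := hadm
    have hω : ω l ≠ 0 := by
      have := horth _ _ _ _ l l ha hb ha hb
      rw [if_pos rfl] at this
      exact left_ne_zero_of_mul (this ▸ one_ne_zero)
    have hswap : ∑ m ∈ Finset.range (j₁ + j₄ + 1),
        ω m * toroidalSymbol J q A j₁ j₂ j₃ j₄ j₅ j₆ m j₈ j₉ * J j₁ j₄ m j₈ j₉ l =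
        ∑ x ∈ Finset.range (j₁ + j₉ + 1), loopValue q x * twist A j₂ j₆ x *
          J j₁ j₂ j₃ j₆ j₉ x * J j₄ j₅ j₆ j₂ x j₈ * ∑ m ∈ Finset.range (j₁ + j₄ + 1),
            ω m * J j₁ j₄ m j₈ j₉ x * J j₁ j₄ m j₈ j₉ l := by
      simp only [toroidalSymbol, e1, Finset.mul_sum, Finset.sum_mul]
      rw [Finset.sum_comm]
      refine Finset.sum_congr rfl fun x _ => Finset.sum_congr rfl fun m _ => ?_
      ring
    rw [hswap, Finset.sum_eq_single l]
    · have := horth _ _ _ _ l l ha hb ha hb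
      rw [if_pos rfl] at this
      rw [hτ]
      linear_combination (τ l * twist A j₂ j₆ l * J j₁ j₂ j₃ j₆ j₉ l * J j₄ j₅ j₆ j₂ l j₈) * this
    · intro x _ hx
      -- If x violates one of these, orthogonality is not available, but the first or the second
      -- 6j-symbol of the toroidal symbol already vanishes.
      by_cases hadm' : Admissible q j₁ j₉ x ∧ Admissible q j₈ j₄ x
      · have := horth _ _ _ _ x l hadm'.1 hadm'.2 ha hb
        rw [if_neg hx] at this
        rw [(mul_eq_zero.mp this).resolve_left hω, mul_zero]
      · rw [not_and_or] at hadm'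
        rcases hadm' with h | h
        · rw [hJ j₁ j₂ j₃ j₆ j₉ x fun t => h t.2.1]; ring
        · rw [hJ j₄ j₅ j₆ j₂ x j₈ fun t => h t.2.1.swap₂₃.swap₁₂]; ring
    · intro hl
      exact absurd (Finset.mem_range.mpr (Nat.lt_succ_of_le ha.2.2.2.1)) hl
  · rw [not_and_or] at hadm
    rw [Finset.sum_eq_zero]
    · rcases hadm with h | h
      · rw [hJ j₁ j₂ j₃ j₆ j₉ l fun t => h t.2.1]; ring
      · rw [hJ j₄ j₅ j₆ j₂ l j₈ fun t => h t.2.1.swap₂₃.swap₁₂]; ring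
    · intro m _
      rw [hJ j₁ j₄ m j₈ j₉ l fun t => hadm.elim (fun h => h t.2.1) fun h => h t.2.2.1, mul_zero]

end

end QSpin

/-- All labels are twice the corresponding spins; `m` is twice the summation spin `μ`, and the
summands vanish for `μ > j₁ + j₄`. The first identity is for the `6j`-symbols of spin networks
with unit theta nets, the second for the Racah–Wigner `6j`-symbols. -/
theorem mainTheorem5 (q A : ℂ) (hq : q ≠ 0) (hA : A ≠ 0)
    (j₁ j₂ j₃ j₄ j₅ j₆ j₈ j₉ l : ℕ) :
    (∑ m ∈ Finset.range (j₁ + j₄ + 1),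
        QSpin.loopValue q m *
          QSpin.toroidalSymbol (QSpin.netSixJ q) q A j₁ j₂ j₃ j₄ j₅ j₆ m j₈ j₉ *
          QSpin.netSixJ q j₁ j₄ m j₈ j₉ l
      = QSpin.twist A j₂ j₆ l *
          QSpin.netSixJ q j₂ j₅ j₈ j₄ l j₆ * QSpin.netSixJ q j₃ j₆ j₉ l j₁ j₂) ∧
    (∑ m ∈ Finset.range (j₁ + j₄ + 1),
        QSpin.qInt q (m + 1) *
          QSpin.toroidalSymbol (QSpin.racahSixJ q) q A j₁ j₂ j₃ j₄ j₅ j₆ m j₈ j₉ *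
          QSpin.racahSixJ q j₁ j₄ m j₈ j₉ l
      = (-1) ^ l * QSpin.twist A j₂ j₆ l *
          QSpin.racahSixJ q j₂ j₅ j₈ j₄ l j₆ * QSpin.racahSixJ q j₃ j₆ j₉ l j₁ j₂) := by
  constructor
  · have h := QSpin.sum_toroidalSymbol_mul (q := q) A (J := QSpin.netSixJ q)
      (ω := QSpin.loopValue q) (τ := fun _ => 1) (fun _ _ _ _ _ _ h => if_neg h)
      (QSpin.netSixJ_swap_columns₁₂ q) (QSpin.netSixJ_swap_columns₂₃ q) (QSpin.netSixJ_swap_rows q)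
      (fun _ => (one_mul _).symm)
      (fun _ _ _ _ _ _ h1 h2 h3 h4 => QSpin.sum_mul_netSixJ hq h1 h2 h3 h4)
      j₁ j₂ j₃ j₄ j₅ j₆ j₈ j₉ l
    simpa only [one_mul] using h
  -- The orthogonality weight is now [2x+1] instead of the loop value; the difference is the sign τ,
  -- which survives as (-1)^(2λ).
  · exact QSpin.sum_toroidalSymbol_mul (q := q) A (J := QSpin.racahSixJ q)
      (ω := fun x => QSpin.qInt q (x + 1)) (τ := fun x => (-1) ^ x)
      (fun _ _ _ _ _ _ h => if_neg h)
      (QSpin.racahSixJ_swap_columns₁₂ q) (QSpin.racahSixJ_swap_columns₂₃ q)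
      (QSpin.racahSixJ_swap_rows q) (fun _ => rfl)
      (fun _ _ _ _ _ _ h1 h2 h3 h4 => QSpin.sum_mul_racahSixJ hq h1 h2 h3 h4)
      j₁ j₂ j₃ j₄ j₅ j₆ j₈ j₉ l
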